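/- Let $K$ be a field (of arbitrary characteristic), let $F \in K[X_0,X_1,X_2]$ be a nonzero homogeneous polynomial of degree $2$, and assume that the conic $C = (F = 0) \subset \mathbb{P}^2_K$ is smooth over $K$. A symmetric determinantal representation of $C$ over $K$ is a triple $(M_0,M_1,M_2)$ of symmetric $2\times 2$ matrices with entries in $K$ such that $C$ is defined by the equation $\det(X_0M_0+X_1M_1+X_2M_2)=0$, that is, $F = a\cdot\det(X_0M_0+X_1M_1+X_2M_2)$ for some $a\in K^\times$. Two such triples $(M_0,M_1,M_2)$ and $(M_0',M_1',M_2')$ are equivalent if there are $P\in \mathrm{GL}_2(K)$ and $a\in K^\times$ with $M_i' = a\,{}^{t}P M_i P$ for $i=0,1,2$. Then the following are equivalent: 1. $C$ is isomorphic to $\mathbb{P}^1_K$ over $K$; 2. $C$ has a $K$-rational point; 3. there is a line bundle of odd degree on $C$ (over $K$); 4. $C$ admits a symmetric determinantal representation over $K$. If these conditions are satisfied, there is exactly one equivalence class of symmetric determinantal representations of $C$ over $K$. -/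

import Mathlib

open CategoryTheory AlgebraicGeometry MvPolynomial TopologicalSpace
open scoped DirectSum

universe u

noncomputable section

/-! ### Plane curves and the projective line -/

section Grading

attribute [local instance] MvPolynomial.gradedAlgebra

variable {K : Type u} [Field K] {n : ℕ}

/-- The homogeneous coordinate ring `K[X₀, X₁, X₂] / (F)` of the plane curve `F = 0`. -/
abbrev CoordRing (F : homogeneousSubmodule (Fin 3) K n) : Type u :=
  MvPolynomial (Fin 3) K ⧸ Ideal.span {(F : MvPolynomial (Fin 3) K)}

/-- The degree `i` part of `K[X₀, X₁, X₂] / (F)`: the classes of the forms of degree `i`. -/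
def coordGrading (F : homogeneousSubmodule (Fin 3) K n) (i : ℕ) : Submodule K (CoordRing F) :=
  (homogeneousSubmodule (Fin 3) K i).map
    (Ideal.Quotient.mkₐ K (Ideal.span {(F : MvPolynomial (Fin 3) K)})).toLinearMap

instance coordGrading.gradedMonoid (F : homogeneousSubmodule (Fin 3) K n) :
    SetLike.GradedMonoid (coordGrading F) where
  one_mem := ⟨1, isHomogeneous_one _ _, map_one (Ideal.Quotient.mkₐ K _)⟩
  mul_mem := by
    rintro i j _ _ ⟨a, ha, rfl⟩ ⟨b, hb, rfl⟩
    exact ⟨a * b, IsHomogeneous.mul ha hb, map_mul (Ideal.Quotient.mkₐ K _) a b⟩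

/-- The map from forms of degree `i` to the degree `i` part of the quotient. -/
def coordGrading.proj (F : homogeneousSubmodule (Fin 3) K n) (i : ℕ) :
    homogeneousSubmodule (Fin 3) K i →ₗ[K] coordGrading F i :=
  (Ideal.Quotient.mkₐ K (Ideal.span {(F : MvPolynomial (Fin 3) K)})).toLinearMap.submoduleMap
    (homogeneousSubmodule (Fin 3) K i)

/-- Taking the classes of the homogeneous components of a polynomial. -/
def coordGrading.components (F : homogeneousSubmodule (Fin 3) K n) :
    MvPolynomial (Fin 3) K →ₐ[K] ⨁ i, coordGrading F i :=
  (DirectSum.toAlgebra K (fun i => homogeneousSubmodule (Fin 3) K i)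
    (fun i => DirectSum.lof K ℕ (fun i => coordGrading F i) i ∘ₗ coordGrading.proj F i)
    (by rfl)
    (by
      intro i j a b
      simp only [LinearMap.comp_apply, DirectSum.lof_eq_of, DirectSum.of_mul_of]
      congr 1)).comp
  (DirectSum.decomposeAlgEquiv (homogeneousSubmodule (Fin 3) K)).toAlgHom

theorem coordGrading.components_apply (F : homogeneousSubmodule (Fin 3) K n) {i : ℕ}
    (p : homogeneousSubmodule (Fin 3) K i) :
    coordGrading.components F (p : MvPolynomial (Fin 3) K) =
      DirectSum.of (fun i => coordGrading F i) i (coordGrading.proj F i p) := by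
  simp only [coordGrading.components, AlgHom.comp_apply]
  change DirectSum.toAlgebra K _ _ _ _ (DirectSum.decompose _ (p : MvPolynomial (Fin 3) K)) = _
  rw [DirectSum.decompose_coe]
  exact DirectSum.toAddMonoid_of _ _ _

instance coordGrading.gradedAlgebra (F : homogeneousSubmodule (Fin 3) K n) :
    GradedAlgebra (coordGrading F) :=
  GradedAlgebra.ofAlgHom (coordGrading F)
    (Ideal.Quotient.liftₐ _ (coordGrading.components F) (by
      intro a ha
      rw [Ideal.mem_span_singleton] at ha
      obtain ⟨b, rfl⟩ := ha
      have h0 : coordGrading.proj F n F = 0 :=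
        Subtype.ext (Ideal.Quotient.eq_zero_iff_mem.mpr (Ideal.mem_span_singleton_self _))
      rw [map_mul, coordGrading.components_apply, h0, map_zero, zero_mul]))
    (by
      apply Ideal.Quotient.algHom_ext
      apply MvPolynomial.algHom_ext
      intro i
      have h := coordGrading.components_apply F
        (⟨X i, isHomogeneous_X K i⟩ : homogeneousSubmodule (Fin 3) K 1)
      simp only [AlgHom.comp_apply, Ideal.Quotient.mkₐ_eq_mk, Ideal.Quotient.liftₐ_apply,
        AlgHom.id_apply]
      erw [h]
      simp only [DirectSum.coeAlgHom_of]
      rfl)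
    (by
      rintro i ⟨_, p, hp, rfl⟩
      exact coordGrading.components_apply F ⟨p, hp⟩)

/-- The structure morphism `Proj A ⟶ Spec K` of a graded `K`-algebra `A`. -/
def projToSpec {A : Type u} [CommRing A] [Algebra K A] (𝒜 : ℕ → Submodule K A)
    [GradedAlgebra 𝒜] : Proj 𝒜 ⟶ Spec (.of K) :=
  Proj.toSpecZero 𝒜 ≫ Spec.map (CommRingCat.ofHom (algebraMap K (𝒜 0)))

/-- The closed subscheme `F = 0` of the projective plane over `K`, as the scheme
`Proj (K[X₀, X₁, X₂] / (F))`; for `F ≠ 0` this is the plane curve of degree `n` defined by `F`. -/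
def PlaneCurve (F : homogeneousSubmodule (Fin 3) K n) : Scheme.{u} :=
  Proj (coordGrading F)

/-- The structure morphism of a plane curve over `K`. -/
def PlaneCurve.toSpec (F : homogeneousSubmodule (Fin 3) K n) :
    PlaneCurve F ⟶ Spec (.of K) :=
  projToSpec (coordGrading F)

variable (K) in
/-- The projective line over `K`, `Proj K[X₀, X₁]`. -/
def ProjectiveLine : Scheme.{u} :=
  Proj (homogeneousSubmodule (Fin 2) K)

variable (K) in
/-- The structure morphism of the projective line over `K`. -/
def ProjectiveLine.toSpec : ProjectiveLine K ⟶ Spec (.of K) :=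
  projToSpec (homogeneousSubmodule (Fin 2) K)

end Grading

/-! ### Line bundles and their degrees -/

section LineBundle

variable {X : Scheme.{u}}

/-- Restriction of sections of a sheaf of modules. -/
def resSection (L : X.Modules) {U V : X.Opens} (h : V ≤ U) (s : Γ(L, U)) : Γ(L, V) :=
  L.presheaf.map (homOfLE h).op s

/-- Restriction of regular functions. -/
def resFun {U V : X.Opens} (h : V ≤ U) (a : Γ(X, U)) : Γ(X, V) :=
  X.presheaf.map (homOfLE h).op a

/-- `e` is a frame of `L` over `U`: multiplication by `e` is an isomorphism of sheaves of modules
from the structure sheaf to `L` over `U`. -/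
def IsFrame (L : X.Modules) (U : X.Opens) (e : Γ(L, U)) : Prop :=
  ∀ (V : X.Opens) (h : V ≤ U),
    Function.Bijective (fun r : Γ(X, V) => (r • resSection L h e : Γ(L, V)))

/-- A line bundle: a sheaf of modules that is locally free of rank one. -/
def IsLineBundle (L : X.Modules) : Prop :=
  ∀ x : X, ∃ U : X.Opens, x ∈ U ∧ ∃ e : Γ(L, U), IsFrame L U e

/-- The rational section `s` of the line bundle `L` has order `m` at the point `x`: in terms of a
frame `e` near `x` it is `(a / b) e`, with `a`, `b` regular functions that are non-zero-divisors
in the local ring `𝒪` at `x`, and `m = length (𝒪 / a) - length (𝒪 / b)`. -/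
def HasOrderAt (L : X.Modules) {U : X.Opens} (s : Γ(L, U)) (x : X) (m : ℤ) : Prop :=
  ∃ (V : X.Opens) (hx : x ∈ V) (e : Γ(L, V)) (a b : Γ(X, V)),
    IsFrame L V e ∧
    X.presheaf.germ V x hx a ∈ nonZeroDivisors (X.presheaf.stalk x) ∧
    X.presheaf.germ V x hx b ∈ nonZeroDivisors (X.presheaf.stalk x) ∧
    resFun (inf_le_right : U ⊓ V ≤ V) b • resSection L (inf_le_left : U ⊓ V ≤ U) s =
      resFun (inf_le_right : U ⊓ V ≤ V) a • resSection L (inf_le_right : U ⊓ V ≤ V) e ∧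
    m = ((Ring.ord (X.presheaf.stalk x) (X.presheaf.germ V x hx a)).toNat : ℤ) -
      ((Ring.ord (X.presheaf.stalk x) (X.presheaf.germ V x hx b)).toNat : ℤ)

/-- The line bundle `L` on the curve `X` over `K` has degree `d`: there is a rational section `s`
of `L`, defined on a dense open subset, whose divisor `∑ D(x) x` has degree
`∑ D(x) [κ(x) : K] = d`. (The degree does not depend on the rational section when `X` is an
integral projective curve.) -/
def HasDegree {K : Type u} [Field K] (f : X ⟶ Spec (.of K)) (L : X.Modules) (d : ℤ) : Prop :=
  ∃ (U : X.Opens) (s : Γ(L, U)) (D : X →₀ ℤ), Dense (U : Set X) ∧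
    (∀ x, HasOrderAt L s x (D x)) ∧
    d = D.sum (fun x m => m * (f.residueDegree x : ℤ))

end LineBundle

/-! ### Symmetric determinantal representations -/

section Representation

variable {K : Type u} [Field K] {n : ℕ}

/-- The determinant `det (X₀ M₀ + X₁ M₁ + X₂ M₂)`. -/
def detForm (M : Fin 3 → Matrix (Fin n) (Fin n) K) : MvPolynomial (Fin 3) K :=
  (∑ i, (X i : MvPolynomial (Fin 3) K) • (M i).map C).det

/-- The triple `M` is a symmetric determinantal representation over `K` of the plane curve
`F = 0` of degree `n`: the `M i` are symmetric of size `n` and the curve is the one defined by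
`det (X₀ M₀ + X₁ M₁ + X₂ M₂)`, i.e. the two forms agree up to a non-zero constant. -/
def IsSymmDetRep (F : homogeneousSubmodule (Fin 3) K n)
    (M : Fin 3 → Matrix (Fin n) (Fin n) K) : Prop :=
  (∀ i, (M i).IsSymm) ∧ ∃ a : Kˣ, (F : MvPolynomial (Fin 3) K) = C (a : K) * detForm M

/-- Equivalence of triples: `N i = a Pᵀ (M i) P` for some invertible `P` and non-zero `a`. -/
def TripleEquiv (M N : Fin 3 → Matrix (Fin n) (Fin n) K) : Prop :=
  ∃ (P : GL (Fin n) K) (a : Kˣ), ∀ i,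
    N i = (a : K) • ((P : Matrix (Fin n) (Fin n) K).transpose * M i * (P : Matrix _ _ K))

end Representation

end

/-!
The conic is related to its equation through two passages between schemes and algebra, after which
everything is a statement about a ternary quadratic form `F`, valid in every characteristic.

* A morphism from the spectrum of a local ring to a plane curve has homogeneous coordinates
  (`PlaneCurve.exists_coordinates`). Hence a rational point is a nonzero zero of `F` over `K`, and a
  point `x` of the curve is a nonzero zero of `F` over the residue field `κ(x)`.
* Smoothness forbids a vertex: by formal smoothness no translation by a nonzero vector leaves `F`
  invariant (`hasNoVertex_of_smooth`).

A rational point `v` gives a determinantal representation, since without a vertex `v` is part of a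
hyperbolic pair and `F` becomes `xy + cz²` (`exists_isSymmDetRep_of_eval_eq_zero`). Conversely the
entries `l₀, l₁` on the diagonal and `l₂` off the diagonal of a representation are independent
linear forms with `F = a (l₀ l₁ - l₂²)`. The parametrization `(s², t², st)` then identifies the
homogeneous coordinate ring with the second Veronese subring of `K[s, t]`, so that the conic is
isomorphic to the projective line (`exists_iso_projectiveLine`), which has rational points.

On a curve isomorphic to the projective line, the ideal sheaf of the point `(0 : 1)` is a line
bundle of degree `-1` (`exists_lineBundle_of_chart`). In the other direction, if a divisor has odd
degree, then one of its points has a residue field of odd degree over `K`. The form `F` has a zero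
over this field, hence one over `K` by Springer's theorem (`springer`), which is proved by descent
on the degree of the extension.

Two representations differ by an automorphism of the space of symmetric `2 × 2` matrices that
multiplies the determinant by a constant, and such an automorphism is `A ↦ c Pᵀ A P`
(`exists_congruence_of_similitude`); this gives uniqueness.
-/

noncomputable section

/-! ### Springer's theorem for quadratic forms -/

section Springer

/-- Scaling the arguments of a form of degree `n` by `g` scales its value by `g ^ n`. -/
theorem aeval_mul_of_isHomogeneous {σ K A : Type*} [CommRing K] [CommRing A] [Algebra K A]
    {F : MvPolynomial σ K} {n : ℕ} (hF : F.IsHomogeneous n) (g : A) (p : σ → A) :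
    aeval (fun i => g * p i) F = g ^ n * aeval p F := by
  classical
  rw [aeval_def, aeval_def, eval₂_eq, eval₂_eq, Finset.mul_sum]
  refine Finset.sum_congr rfl fun d hd => ?_
  have h : ∏ i ∈ d.support, g ^ d i = g ^ n := by
    rw [Finset.prod_pow_eq_pow_sum]
    congr 1
    rw [← hF (mem_support_iff.mp hd), Finsupp.weight_apply]
    simp [Finsupp.sum]
  simp_rw [mul_pow, Finset.prod_mul_distrib, h]
  ring

theorem coeff_prod_sum_of_natDegree_le {ι R : Type*} [CommRing R] (s : Finset ι)
    (q : ι → Polynomial R) (n : ι → ℕ) (h : ∀ i ∈ s, (q i).natDegree ≤ n i) :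
    (∏ i ∈ s, q i).natDegree ≤ ∑ i ∈ s, n i ∧
      (∏ i ∈ s, q i).coeff (∑ i ∈ s, n i) = ∏ i ∈ s, (q i).coeff (n i) := by
  classical
  induction s using Finset.induction_on with
  | empty => simp
  | insert a s ha ih =>
    obtain ⟨h1, h2⟩ := ih fun i hi => h i (Finset.mem_insert_of_mem hi)
    have h3 := h a (Finset.mem_insert_self a s)
    rw [Finset.prod_insert ha, Finset.sum_insert ha, Finset.prod_insert ha]
    exact ⟨Polynomial.natDegree_mul_le_of_le h3 h1, by
      rw [Polynomial.coeff_mul_add_eq_of_natDegree_le h3 h1, h2]⟩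

/-- Substituting polynomials of degree at most `m` into a form of degree `n` gives a polynomial of
degree at most `n * m`, whose coefficient in that degree is the value of the form at the vector
of coefficients of degree `m`. -/
theorem aeval_polynomial_coeff {σ K : Type*} [CommRing K] {F : MvPolynomial σ K} {n : ℕ}
    (hF : F.IsHomogeneous n) (p : σ → Polynomial K) (m : ℕ) (hp : ∀ i, (p i).natDegree ≤ m) :
    (aeval p F).natDegree ≤ n * m ∧
      (aeval p F).coeff (n * m) = eval (fun i => (p i).coeff m) F := by
  classical
  have key : ∀ d ∈ F.support, ((∏ i ∈ d.support, p i ^ d i).natDegree ≤ n * m ∧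
      (∏ i ∈ d.support, p i ^ d i).coeff (n * m) = ∏ i ∈ d.support, (p i).coeff m ^ d i) := by
    intro d hd
    have h : ∑ i ∈ d.support, d i * m = n * m := by
      rw [← Finset.sum_mul]
      congr 1
      rw [← hF (mem_support_iff.mp hd), Finsupp.weight_apply]
      simp [Finsupp.sum]
    have := coeff_prod_sum_of_natDegree_le d.support (fun i => p i ^ d i) (fun i => d i * m)
      fun i _ => Polynomial.natDegree_pow_le_of_le _ (hp i)
    rw [h] at this
    refine ⟨this.1, this.2.trans (Finset.prod_congr rfl fun i _ => ?_)⟩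
    rw [Polynomial.coeff_pow_of_natDegree_le (hp i)]
  rw [aeval_def, eval₂_eq, eval_eq]
  refine ⟨Polynomial.natDegree_sum_le_of_forall_le _ _ fun d hd =>
    (Polynomial.natDegree_C_mul_le _ _).trans (key d hd).1, ?_⟩
  rw [Polynomial.finsetSum_coeff]
  refine Finset.sum_congr rfl fun d hd => ?_
  rw [Polynomial.algebraMap_eq, Polynomial.coeff_C_mul, (key d hd).2]

theorem exists_irreducible_dvd_odd_natDegree {K : Type*} [Field K] (h : Polynomial K)
    (hodd : Odd h.natDegree) : ∃ q, Irreducible q ∧ q ∣ h ∧ Odd q.natDegree := by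
  induction h using WfDvdMonoid.induction_on_irreducible with
  | zero => simp at hodd
  | unit x hx => simp [Polynomial.natDegree_eq_zero_of_isUnit hx] at hodd
  | mul a i ha hi ih =>
    rw [Polynomial.natDegree_mul hi.ne_zero ha, Nat.odd_add'] at hodd
    by_cases h1 : Odd a.natDegree
    · obtain ⟨q, hq, hd, ho⟩ := ih h1
      exact ⟨q, hq, hd.mul_left i, ho⟩
    · exact ⟨i, hi, dvd_mul_right i a, by
        rw [← Nat.not_even_iff_odd]; intro h; exact h1 (hodd.mpr h)⟩

/-- The descent in Springer's theorem. A zero of a quadratic form modulo an irreducible polynomial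
of odd degree is represented by coprime polynomials of smaller degree; if the form has no zero
over `K`, its value at these has even degree, so the complementary factor has odd degree and the
degree goes down. -/
theorem exists_zero_of_irreducible_dvd {σ K : Type*} [Finite σ] [Field K] {F : MvPolynomial σ K}
    (hF : F.IsHomogeneous 2) (n : ℕ) :
    ∀ (f : Polynomial K), f.natDegree = n → Odd n → Irreducible f →
      ∀ p : σ → Polynomial K, f ∣ aeval p F → (∃ i, ¬ f ∣ p i) →
        ∃ w : σ → K, w ≠ 0 ∧ eval w F = 0 := by
  classical
  have := Fintype.ofFinite σ
  induction n using Nat.strong_induction_on with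
  | _ n ih =>
  intro f hfn hodd hf p hfp ⟨i₀, hi₀⟩
  by_contra! hA
  set r : σ → Polynomial K := fun i => p i % f with hr
  have hmk : ∀ i, Ideal.Quotient.mkₐ K (Ideal.span {f}) (r i) =
      Ideal.Quotient.mkₐ K (Ideal.span {f}) (p i) := fun i => by
    rw [Ideal.Quotient.mkₐ_eq_mk, Ideal.Quotient.eq, Ideal.mem_span_singleton, ← dvd_neg, neg_sub]
    exact ⟨p i / f, by rw [hr]; linear_combination -EuclideanDomain.div_add_mod (p i) f⟩
  have hfr : f ∣ aeval r F := by
    rw [← Ideal.mem_span_singleton, ← Ideal.Quotient.eq_zero_iff_mem,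
      ← Ideal.Quotient.mkₐ_eq_mk K] at hfp ⊢
    rw [← hfp, comp_aeval_apply, comp_aeval_apply]
    simp only [hmk]
  have hr0 : r i₀ ≠ 0 := fun h => hi₀ (EuclideanDomain.mod_eq_zero.mp h)
  have hrdeg : ∀ i, (r i).natDegree < n := fun i =>
    hfn ▸ Polynomial.natDegree_mod_lt _ (by rw [hfn]; rintro rfl; simp at hodd)
  obtain ⟨g, hg⟩ := (inferInstance : (Ideal.span (Set.range r)).IsPrincipal)
  rw [Ideal.submodule_span_eq] at hg
  have hgr : ∀ i, g ∣ r i := fun i => by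
    rw [← Ideal.mem_span_singleton, ← hg]; exact Ideal.subset_span ⟨i, rfl⟩
  choose q hq using hgr
  have hg0 : g ≠ 0 := by rintro rfl; exact hr0 (by rw [hq, zero_mul])
  have hfg : ¬ f ∣ g := fun h => by
    have h1 := Polynomial.natDegree_le_of_dvd (h.trans ⟨_, hq i₀⟩) hr0
    have := hrdeg i₀
    omega
  have hqdeg : ∀ i, (q i).natDegree < n := fun i => by
    rcases eq_or_ne (q i) 0 with h | h
    · rw [h, Polynomial.natDegree_zero]; exact hodd.pos
    · exact (Polynomial.natDegree_le_of_dvd ⟨g, by rw [hq, mul_comm]⟩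
        (by rw [hq]; exact mul_ne_zero hg0 h)).trans_lt (hrdeg i)
  have hfq : f ∣ aeval q F := by
    have h1 : aeval r F = g ^ 2 * aeval q F := by
      rw [← aeval_mul_of_isHomogeneous hF]; congr 2; ext1 i; exact hq i
    rw [h1] at hfr
    exact (hf.prime.dvd_or_dvd hfr).resolve_left fun h => hfg (hf.prime.dvd_of_dvd_pow h)
  have huni : ∀ x : Polynomial K, (∀ i, x ∣ q i) → IsUnit x := by
    intro x hx
    have h1 : Ideal.span {g} ≤ Ideal.span {g * x} := by
      rw [← hg, Ideal.span_le]
      rintro _ ⟨i, rfl⟩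
      rw [SetLike.mem_coe, Ideal.mem_span_singleton, hq]
      exact mul_dvd_mul_left g (hx i)
    rw [Ideal.span_singleton_le_span_singleton] at h1
    exact isUnit_of_dvd_one ((mul_dvd_mul_iff_left hg0).mp (by simpa using h1))
  -- The largest degree of the `q i`: since they are coprime, some `q i` is nonzero, and the vector
  -- of the coefficients in that degree does not vanish.
  obtain ⟨i₁, -, hi₁⟩ := Finset.exists_max_image Finset.univ (fun i => (q i).natDegree)
    ⟨i₀, by simp⟩
  set m := (q i₁).natDegree with hm
  have hlead : (fun i => (q i).coeff m) ≠ 0 := by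
    intro h
    have h1 : q i₁ = 0 := Polynomial.leadingCoeff_eq_zero.mp (congrFun h i₁)
    have h2 : q i₀ ≠ 0 := fun h => hr0 (by rw [hq, h, mul_zero])
    have h3 : m = 0 := by rw [hm, h1, Polynomial.natDegree_zero]
    have h4 : (q i₀).natDegree ≤ 0 := h3 ▸ hi₁ i₀ (by simp)
    have h5 := congrFun h i₀
    rw [Polynomial.eq_C_of_natDegree_le_zero h4] at h2
    rw [h3] at h5
    exact h2 (by rw [show (q i₀).coeff 0 = 0 from h5, map_zero])
  obtain ⟨hle, hco⟩ := aeval_polynomial_coeff hF q m fun i => hi₁ i (by simp)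
  have hne : (aeval q F).coeff (2 * m) ≠ 0 := by rw [hco]; exact hA _ hlead
  have hdeg : (aeval q F).natDegree = 2 * m :=
    le_antisymm hle (Polynomial.le_natDegree_of_ne_zero hne)
  obtain ⟨h, hh⟩ := hfq
  have hG0 : aeval q F ≠ 0 := by intro h; rw [h] at hne; simp at hne
  have hh0 : h ≠ 0 := by rintro rfl; exact hG0 (by rw [hh, mul_zero])
  rw [hh, Polynomial.natDegree_mul hf.ne_zero hh0, hfn] at hdeg
  have hmn : m < n := hqdeg i₁
  have hhodd : Odd h.natDegree := by
    obtain ⟨a, ha⟩ := hodd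
    exact ⟨m - a - 1, by omega⟩
  obtain ⟨x, hx, hxh, hxodd⟩ := exists_irreducible_dvd_odd_natDegree h hhodd
  have hxle := Polynomial.natDegree_le_of_dvd hxh hh0
  obtain ⟨w, hw, hw0⟩ := ih x.natDegree (by omega) x rfl hxodd hx q
    (hh ▸ hxh.mul_left f) (by by_contra! hc; exact hx.not_isUnit (huni x hc))
  exact hA w hw hw0

/-- **Springer's theorem**: a quadratic form with a nontrivial zero over an extension of odd degree
has a nontrivial zero over the base field. The characteristic is arbitrary. -/
theorem springer {σ : Type*} [Finite σ] (n : ℕ) : ∀ {K L : Type u} [Field K] [Field L]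
    [Algebra K L] {F : MvPolynomial σ K}, F.IsHomogeneous 2 → Module.finrank K L = n → Odd n →
    ∀ v : σ → L, v ≠ 0 → aeval v F = 0 → ∃ w : σ → K, w ≠ 0 ∧ eval w F = 0 := by
  induction n using Nat.strong_induction_on with
  | _ n ih =>
  intro K L _ _ _ F hF hn hodd v hv h0
  have hfin : FiniteDimensional K L := Module.finite_of_finrank_pos (hn ▸ hodd.pos)
  by_cases htop : ∀ α : L, α ∈ (⊥ : IntermediateField K L)
  · simp only [IntermediateField.mem_bot, Set.mem_range] at htop
    choose w hw using fun i => htop (v i)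
    refine ⟨w, fun h => hv (funext fun i => by rw [← hw, h]; simp), ?_⟩
    obtain rfl : (fun i => algebraMap K L (w i)) = v := funext hw
    exact (algebraMap K L).injective (by
      rw [map_zero, ← h0]; exact comp_aeval_apply w (Algebra.ofId K L) F)
  push Not at htop
  obtain ⟨α, hα⟩ := htop
  have hint := IsIntegral.of_finite K α
  have hmul := Module.finrank_mul_finrank K (IntermediateField.adjoin K {α}) L
  rw [hn] at hmul
  have hodd1 : Odd (Module.finrank K (IntermediateField.adjoin K {α})) :=
    (Nat.odd_mul.mp (hmul ▸ hodd)).1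
  have hodd2 : Odd (Module.finrank (IntermediateField.adjoin K {α}) L) :=
    (Nat.odd_mul.mp (hmul ▸ hodd)).2
  have hgt : Module.finrank K (IntermediateField.adjoin K {α}) ≠ 1 := by
    rw [Ne, IntermediateField.finrank_eq_one_iff, IntermediateField.adjoin_simple_eq_bot_iff]
    exact hα
  obtain ⟨w, hw, hw0⟩ : ∃ w : σ → IntermediateField.adjoin K {α}, w ≠ 0 ∧ aeval w F = 0 := by
    obtain ⟨w, hw, hw0⟩ := ih _ (by
      have h1 := hodd1.pos
      have h2 := hodd2.pos
      nlinarith [show 2 ≤ Module.finrank K (IntermediateField.adjoin K {α}) by omega])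
      (hF.map (algebraMap K (IntermediateField.adjoin K {α}))) rfl hodd2 v hv
      (by rw [aeval_map_algebraMap, h0])
    exact ⟨w, hw, by rwa [MvPolynomial.eval_map, ← aeval_def] at hw0⟩
  have hsurj : ∀ x : IntermediateField.adjoin K {α}, ∃ p : Polynomial K,
      Polynomial.aeval (IntermediateField.AdjoinSimple.gen K α) p = x := by
    intro x
    exact (IntermediateField.adjoin.powerBasis hint).exists_eq_aeval' x |>.imp fun p h => by
      rw [h, IntermediateField.adjoin.powerBasis_gen]
  choose p hp using fun i => hsurj (w i)
  have hmin : ∀ q : Polynomial K, minpoly K α ∣ q ↔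
      Polynomial.aeval (IntermediateField.AdjoinSimple.gen K α) q = 0 := fun q => by
    rw [← IntermediateField.minpoly_gen, minpoly.dvd_iff]
  refine exists_zero_of_irreducible_dvd hF _ (minpoly K α) rfl
    (by rwa [← IntermediateField.adjoin.finrank hint]) (minpoly.irreducible hint) p ?_ ?_
  · rw [hmin, comp_aeval_apply]
    simpa only [hp] using hw0
  · by_contra! hc
    exact hw (funext fun i => by rw [← hp i, Pi.zero_apply, ← hmin]; exact hc i)

end Springer

/-! ### Ternary quadratic forms and symmetric determinantal representations -/

section TernaryForms

variable {K : Type u} [Field K]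

/-- The form `F` has no `K`-rational vertex: translation by a nonzero vector never leaves `F`
invariant. For quadratic forms this says that every nonzero isotropic vector over `K` is a
nonsingular point of the conic. -/
def HasNoVertex (F : MvPolynomial (Fin 3) K) : Prop :=
  ∀ v : Fin 3 → K, aeval (fun j => X j + C (v j) : Fin 3 → MvPolynomial (Fin 3) K) F = F → v = 0

theorem exists_coeff_of_isHomogeneous_two {F : MvPolynomial (Fin 3) K} (hF : F.IsHomogeneous 2) :
    ∃ a b c d e f : K, F = C a * X 0 ^ 2 + C b * X 1 ^ 2 + C c * X 2 ^ 2 + C d * (X 0 * X 1) +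
      C e * (X 0 * X 2) + C f * (X 1 * X 2) := by
  have h : F ∈ homogeneousSubmodule (Fin 3) K 1 * homogeneousSubmodule (Fin 3) K 1 := by
    rw [← pow_two, homogeneousSubmodule_one_pow]; exact hF
  have hlin : ∀ p ∈ homogeneousSubmodule (Fin 3) K 1, ∃ a b c : K,
      p = C a * X 0 + C b * X 1 + C c * X 2 := by
    intro p hp
    rw [homogeneousSubmodule_one_eq_span_X, Submodule.mem_span_range_iff_exists_fun] at hp
    obtain ⟨c, rfl⟩ := hp
    exact ⟨c 0, c 1, c 2, by simp [Fin.sum_univ_three, smul_eq_C_mul]⟩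
  induction h using Submodule.mul_induction_on' with
  | mem_mul_mem p hp q hq =>
    obtain ⟨a, b, c, rfl⟩ := hlin p hp
    obtain ⟨a', b', c', rfl⟩ := hlin q hq
    exact ⟨a * a', b * b', c * c', a * b' + b * a', a * c' + c * a', b * c' + c * b', by
      simp only [map_add, map_mul]; ring⟩
  | add p hp q hq h1 h2 =>
    obtain ⟨a, b, c, d, e, f, h1⟩ := h1 ((homogeneousSubmodule_mul 1 1) hp)
    obtain ⟨a', b', c', d', e', f', h2⟩ := h2 ((homogeneousSubmodule_mul 1 1) hq)
    exact ⟨a + a', b + b', c + c', d + d', e + e', f + f', by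
      rw [h1, h2]; simp only [map_add]; ring⟩

theorem aeval_matrix_toMvPolynomial {R : Type*} [CommRing R] [Algebra K R]
    (S : Matrix (Fin 3) (Fin 3) K) (p : Fin 3 → R) (i : Fin 3) :
    aeval p (S.toMvPolynomial i) = ∑ j, algebraMap K R (S i j) * p j := by
  simp [Matrix.toMvPolynomial, aeval_monomial]

theorem toMvPolynomial_eq_sum (S : Matrix (Fin 3) (Fin 3) K) (i : Fin 3) :
    S.toMvPolynomial i = ∑ j, C (S i j) * X j := by
  simpa using aeval_matrix_toMvPolynomial S (X : Fin 3 → MvPolynomial (Fin 3) K) i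

/-- A vector `v` with `F v = 0` lies in a hyperbolic pair, since `F` has no vertex; in coordinates
adapted to that pair `F` is `xy + cz²` with `c ≠ 0`, a multiple of the determinant of the matrix
with rows `(x, -cz)` and `(-cz, -cy)`. -/
theorem exists_isSymmDetRep_of_eval_eq_zero (F : homogeneousSubmodule (Fin 3) K 2)
    (hvert : HasNoVertex (F : MvPolynomial (Fin 3) K)) {v : Fin 3 → K} (hv : v ≠ 0)
    (h0 : eval v (F : MvPolynomial (Fin 3) K) = 0) :
    ∃ M : Fin 3 → Matrix (Fin 2) (Fin 2) K, IsSymmDetRep F M := by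
  obtain ⟨F, hF⟩ := F
  simp only at hvert h0
  obtain ⟨a, b, c, d, e, f, rfl⟩ := exists_coeff_of_isHomogeneous_two hF
  set Q : (Fin 3 → K) → K := fun x => a * x 0 ^ 2 + b * x 1 ^ 2 + c * x 2 ^ 2 + d * (x 0 * x 1) +
      e * (x 0 * x 2) + f * (x 1 * x 2) with hQ
  set B : (Fin 3 → K) → (Fin 3 → K) → K := fun x y => 2 * a * x 0 * y 0 + 2 * b * x 1 * y 1 +
      2 * c * x 2 * y 2 + d * (x 0 * y 1 + x 1 * y 0) +
      e * (x 0 * y 2 + x 2 * y 0) + f * (x 1 * y 2 + x 2 * y 1) with hB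
  have hQv : Q v = 0 := by simpa [hQ] using h0
  -- The linear form `B v` does not vanish, since `v` is not a vertex.
  obtain ⟨u₀, hu₀⟩ : ∃ u, B v u = 1 := by
    by_contra! hc
    have hz : ∀ y, B v y = 0 := fun y => by
      by_contra hy
      refine hc (fun i => (B v y)⁻¹ * y i) ?_
      have : B v (fun i => (B v y)⁻¹ * y i) = (B v y)⁻¹ * B v y := by
        conv_lhs => rw [hB]
        conv_rhs => arg 2; rw [hB]
        ring
      rw [this, inv_mul_cancel₀ hy]
    apply hv
    apply hvert
    have e0 := hz ![1, 0, 0]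
    have e1 := hz ![0, 1, 0]
    have e2 := hz ![0, 0, 1]
    simp only [hB, Matrix.cons_val] at e0 e1 e2
    replace e0 := congrArg (C : K →+* MvPolynomial (Fin 3) K) e0
    replace e1 := congrArg (C : K →+* MvPolynomial (Fin 3) K) e1
    replace e2 := congrArg (C : K →+* MvPolynomial (Fin 3) K) e2
    replace hQv := congrArg (C : K →+* MvPolynomial (Fin 3) K) hQv
    simp only [hQ, map_add, map_mul, map_pow, map_zero, map_one, map_ofNat] at e0 e1 e2 hQv
    simp only [map_add, map_mul, map_pow, aeval_X, aeval_C, algebraMap_eq]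
    linear_combination hQv + X 0 * e0 + X 1 * e1 + X 2 * e2
  -- Subtracting a multiple of `v` from `u₀` completes `v` to a hyperbolic pair.
  obtain ⟨u, hvu, hQu⟩ : ∃ u, B v u = 1 ∧ Q u = 0 := by
    refine ⟨fun i => u₀ i - Q u₀ * v i, ?_, ?_⟩
    · have : B v (fun i => u₀ i - Q u₀ * v i) = B v u₀ - Q u₀ * (2 * Q v) := by
        generalize Q u₀ = r
        simp only [hB, hQ]; ring
      rw [this, hQv, hu₀]; ring
    · have : ∀ r, Q (fun i => u₀ i - r * v i) = Q u₀ - r * B v u₀ + r ^ 2 * Q v := by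
        intro r
        simp only [hB, hQ]; ring
      rw [this, hQv, hu₀]; ring
  -- The vectors `v` and `u` are independent: if all `3 × 3` determinants with these columns vanish,
  -- then `B v u • v = 2 Q v • u = 0`.
  obtain ⟨w₀, hw₀⟩ : ∃ w : Fin 3 → K, (Matrix.of fun i j => ![v i, u i, w i] j).det ≠ 0 := by
    by_contra! hc
    have c0 := hc ![1, 0, 0]
    have c1 := hc ![0, 1, 0]
    have c2 := hc ![0, 0, 1]
    simp [Matrix.det_fin_three] at c0 c1 c2
    have key : ∀ i, v i = 0 := by
      have : ∀ i, v i * B v u = u i * (2 * Q v) := by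
        intro i
        simp only [hB, hQ]
        fin_cases i <;> simp only [Fin.zero_eta, Fin.mk_one, Fin.reduceFinMk]
        · linear_combination (2 * b * v 1 + f * v 2 + d * v 0) * c2 -
            (2 * c * v 2 + f * v 1 + e * v 0) * c1
        · linear_combination -(2 * a * v 0 + d * v 1 + e * v 2) * c2 +
            (2 * c * v 2 + f * v 1 + e * v 0) * c0
        · linear_combination (2 * a * v 0 + d * v 1 + e * v 2) * c1 -
            (2 * b * v 1 + f * v 2 + d * v 0) * c0
      intro i
      have h := this i
      rwa [hvu, hQv, mul_one, mul_zero, mul_zero] at h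
    exact hv (funext key)
  -- The third basis vector can be chosen orthogonal to the hyperbolic pair.
  obtain ⟨w, hvw, huw, hw⟩ : ∃ w, B v w = 0 ∧ B u w = 0 ∧
      (Matrix.of fun i j => ![v i, u i, w i] j).det ≠ 0 := by
    refine ⟨fun i => w₀ i - B u w₀ * v i - B v w₀ * u i, ?_, ?_, ?_⟩
    · have : ∀ r s, B v (fun i => w₀ i - r * v i - s * u i) =
          B v w₀ - r * (2 * Q v) - s * B v u := by
        intro r s; simp only [hB, hQ]; ring
      rw [this, hQv, hvu]; ring
    · have : ∀ r s, B u (fun i => w₀ i - r * v i - s * u i) =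
          B u w₀ - r * B v u - s * (2 * Q u) := by
        intro r s; simp only [hB, hQ]; ring
      rw [this, hQu, hvu]; ring
    · generalize B u w₀ = r
      generalize B v w₀ = s
      convert hw₀ using 1
      simp [Matrix.det_fin_three]; ring
  set T : Matrix (Fin 3) (Fin 3) K := Matrix.of fun i j => ![v i, u i, w i] j with hT
  set S := T⁻¹ with hS
  have hTS : T * S = 1 := Matrix.mul_nonsing_inv _ (isUnit_iff_ne_zero.mpr hw)
  -- The old coordinates in terms of the coordinates with respect to the basis `v, u, w`.
  have hX : ∀ i, (X i : MvPolynomial (Fin 3) K) =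
      C (v i) * S.toMvPolynomial 0 + C (u i) * S.toMvPolynomial 1 +
        C (w i) * S.toMvPolynomial 2 := by
    intro i
    have h := Matrix.toMvPolynomial_mul T S i
    rw [hTS, Matrix.toMvPolynomial_one] at h
    rw [h]
    change aeval _ _ = _
    rw [aeval_matrix_toMvPolynomial, Fin.sum_univ_three]
    simp [hT]
  generalize hl0 : S.toMvPolynomial 0 = l0 at hX
  generalize hl1 : S.toMvPolynomial 1 = l1 at hX
  generalize hl2 : S.toMvPolynomial 2 = l2 at hX
  have hform : C a * X 0 ^ 2 + C b * X 1 ^ 2 + C c * X 2 ^ 2 + C d * (X 0 * X 1) +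
      C e * (X 0 * X 2) + C f * (X 1 * X 2) = l0 * l1 + C (Q w) * l2 ^ 2 := by
    rw [hX 0, hX 1, hX 2]
    have q0 := congrArg (C : K →+* MvPolynomial (Fin 3) K) hQv
    have q1 := congrArg (C : K →+* MvPolynomial (Fin 3) K) hQu
    have b0 := congrArg (C : K →+* MvPolynomial (Fin 3) K) hvu
    have b1 := congrArg (C : K →+* MvPolynomial (Fin 3) K) hvw
    have b2 := congrArg (C : K →+* MvPolynomial (Fin 3) K) huw
    simp only [hQ, hB, map_add, map_mul, map_pow, map_zero, map_one, map_ofNat] at q0 q1 b0 b1 b2 ⊢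
    linear_combination l0 ^ 2 * q0 + l1 ^ 2 * q1 + l0 * l1 * b0 + l0 * l2 * b1 + l1 * l2 * b2
  -- Otherwise `w` is orthogonal to everything and isotropic, hence a vertex.
  have hQw : Q w ≠ 0 := by
    intro hQw
    refine hw ?_
    have : w = 0 := by
      apply hvert
      have q0 := congrArg (C : K →+* MvPolynomial (Fin 3) K) hQw
      have b1 := congrArg (C : K →+* MvPolynomial (Fin 3) K) hvw
      have b2 := congrArg (C : K →+* MvPolynomial (Fin 3) K) huw
      simp only [map_add, map_mul, map_pow, aeval_X, aeval_C, algebraMap_eq]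
      rw [hX 0, hX 1, hX 2]
      simp only [hQ, hB, map_add, map_mul, map_pow, map_zero, map_ofNat] at q0 b1 b2 ⊢
      linear_combination (1 + 2 * l2) * q0 + l0 * b1 + l1 * b2
    subst this
    simp [hT, Matrix.det_fin_three]
  refine ⟨fun k => !![S 0 k, -(Q w) * S 2 k; -(Q w) * S 2 k, -(Q w) * S 1 k], fun i => ?_,
    (Units.mk0 _ (inv_ne_zero (neg_ne_zero.mpr hQw))), ?_⟩
  · ext i j; fin_cases i <;> fin_cases j <;> simp
  · change C a * X 0 ^ 2 + C b * X 1 ^ 2 + C c * X 2 ^ 2 + C d * (X 0 * X 1) +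
      C e * (X 0 * X 2) + C f * (X 1 * X 2) = _
    rw [hform, Units.val_mk0]
    have hdet : detForm (fun k => !![S 0 k, -(Q w) * S 2 k; -(Q w) * S 2 k, -(Q w) * S 1 k]) =
        C (-(Q w)) * (l0 * l1 + C (Q w) * l2 ^ 2) := by
      rw [← hl0, ← hl1, ← hl2, toMvPolynomial_eq_sum, toMvPolynomial_eq_sum, toMvPolynomial_eq_sum]
      generalize Q w = r
      simp [detForm, Matrix.det_fin_two, Fin.sum_univ_three]
      ring
    rw [hdet, ← mul_assoc, ← C_mul, inv_mul_cancel₀ (neg_ne_zero.mpr hQw), C_1, one_mul]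

/-- The matrix of the linear map `x ↦ ∑ xᵢ Mᵢ` to symmetric matrices, in the coordinates given by
the entries `00`, `11` and `01`. -/
def entryMatrix (M : Fin 3 → Matrix (Fin 2) (Fin 2) K) : Matrix (Fin 3) (Fin 3) K :=
  Matrix.of fun j k => ![M k 0 0, M k 1 1, M k 0 1] j

theorem detForm_eq_of_isSymm {M : Fin 3 → Matrix (Fin 2) (Fin 2) K} (hM : ∀ i, (M i).IsSymm) :
    detForm M = (entryMatrix M).toMvPolynomial 0 * (entryMatrix M).toMvPolynomial 1 -
      (entryMatrix M).toMvPolynomial 2 ^ 2 := by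
  have h : ∀ i, M i 1 0 = M i 0 1 := fun i => (hM i).apply 0 1
  rw [toMvPolynomial_eq_sum, toMvPolynomial_eq_sum, toMvPolynomial_eq_sum]
  simp [detForm, entryMatrix, Matrix.det_fin_two, Fin.sum_univ_three, h]
  ring

/-- The entries of a determinantal representation are independent linear forms: `F` is a polynomial
in them, so it is invariant under translation by a common zero. -/
theorem det_entryMatrix_ne_zero {F : homogeneousSubmodule (Fin 3) K 2}
    (hvert : HasNoVertex (F : MvPolynomial (Fin 3) K)) {M : Fin 3 → Matrix (Fin 2) (Fin 2) K}
    (hM : IsSymmDetRep F M) : (entryMatrix M).det ≠ 0 := by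
  intro h
  obtain ⟨v, hv, hv0⟩ := Matrix.exists_mulVec_eq_zero_iff.mpr h
  refine hv (hvert v ?_)
  obtain ⟨hs, a, ha⟩ := hM
  have hl : ∀ i, aeval (fun j => X j + C (v j) : Fin 3 → MvPolynomial (Fin 3) K)
      ((entryMatrix M).toMvPolynomial i) = (entryMatrix M).toMvPolynomial i := by
    intro i
    have h1 := congrArg (C : K →+* MvPolynomial (Fin 3) K) (congrFun hv0 i)
    rw [aeval_matrix_toMvPolynomial, toMvPolynomial_eq_sum]
    simp only [Matrix.mulVec, dotProduct, Fin.sum_univ_three, map_add, map_mul, Pi.zero_apply,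
      map_zero, algebraMap_eq] at h1 ⊢
    linear_combination h1
  rw [ha, detForm_eq_of_isSymm hs]
  simp only [map_mul, map_sub, map_pow, hl, aeval_C, algebraMap_eq]

end TernaryForms

/-! ### Similitudes of the determinant on symmetric matrices -/

section Uniqueness

variable {K : Type u} [Field K]

/-- A singular symmetric `2 × 2` matrix is a multiple of some `(x, y)ᵀ (x, y)`. -/
theorem exists_rank_one_of_mul_eq_sq {p r s : K} (h : p * r = s ^ 2) :
    ∃ c x y : K, p = c * x ^ 2 ∧ r = c * y ^ 2 ∧ s = c * (x * y) := by
  rcases eq_or_ne p 0 with rfl | hp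
  · have hs : s = 0 := by simpa using h.symm
    exact ⟨r, 0, 1, by simp, by simp, by simp [hs]⟩
  · exact ⟨p, 1, s / p, by simp, by field_simp; linear_combination h, by field_simp⟩

/-- A similitude of the determinant on symmetric `2 × 2` matrices is `A ↦ c Pᵀ A P`, also in
characteristic `2`: the images of the two diagonal matrix units have rank one, so they are
multiples of `v vᵀ` and `w wᵀ`, and the image of the third basis vector is then a multiple of
`v wᵀ + w vᵀ`. -/
theorem exists_congruence_of_similitude (U : Matrix (Fin 3) (Fin 3) K) {l : K} (hl : l ≠ 0)
    (hU : ∀ y : Fin 3 → K, (U.mulVec y) 0 * (U.mulVec y) 1 - (U.mulVec y) 2 ^ 2 =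
      l * (y 0 * y 1 - y 2 ^ 2)) :
    ∃ (P : GL (Fin 2) K) (a : Kˣ), ∀ y : Fin 3 → K,
      !![(U.mulVec y) 0, (U.mulVec y) 2; (U.mulVec y) 2, (U.mulVec y) 1] =
        (a : K) • ((P : Matrix (Fin 2) (Fin 2) K).transpose * !![y 0, y 2; y 2, y 1] *
          (P : Matrix _ _ K)) := by
  have h0 := hU ![1, 0, 0]
  have h1 := hU ![0, 1, 0]
  have h2 := hU ![0, 0, 1]
  have h01 := hU ![1, 1, 0]
  have h02 := hU ![1, 0, 1]
  have h12 := hU ![0, 1, 1]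
  simp only [Matrix.mulVec, dotProduct, Fin.sum_univ_three, Matrix.cons_val] at h0 h1 h2 h01 h02 h12
  obtain ⟨c, x, y, hp0, hr0, hs0⟩ := exists_rank_one_of_mul_eq_sq
    (p := U 0 0) (r := U 1 0) (s := U 2 0) (by linear_combination h0)
  obtain ⟨c', z, w, hp1, hr1, hs1⟩ := exists_rank_one_of_mul_eq_sq
    (p := U 0 1) (r := U 1 1) (s := U 2 1) (by linear_combination h1)
  have hlam : c * c' * (x * w - y * z) ^ 2 = l := by
    rw [hp0, hr0, hs0, hp1, hr1, hs1] at h01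
    linear_combination h01
  have hδ : x * w - y * z ≠ 0 := by rintro h; rw [h] at hlam; apply hl; rw [← hlam]; ring
  have hc : c ≠ 0 := by rintro rfl; apply hl; rw [← hlam]; ring
  have hc' : c' ≠ 0 := by rintro rfl; apply hl; rw [← hlam]; ring
  set δ := x * w - y * z with hδd
  -- The coefficients of the cross terms say that the third image is orthogonal to the first two;
  -- this determines it up to the scalar `q`.
  have hA : y ^ 2 * U 0 2 - 2 * x * y * U 2 2 + x ^ 2 * U 1 2 = 0 := by
    refine (mul_eq_zero_iff_left hc).mp ?_
    rw [hp0, hr0, hs0] at h02 h0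
    linear_combination h02 - h2
  have hC : w ^ 2 * U 0 2 - 2 * z * w * U 2 2 + z ^ 2 * U 1 2 = 0 := by
    refine (mul_eq_zero_iff_left hc').mp ?_
    rw [hp1, hr1, hs1] at h12
    linear_combination h12 - h2
  obtain ⟨q, hq⟩ : ∃ q, q * δ ^ 2 = -(y * w) * U 0 2 + (x * w + y * z) * U 2 2 - z * x * U 1 2 :=
    ⟨_ / δ ^ 2, div_mul_cancel₀ _ (pow_ne_zero 2 hδ)⟩
  have hδ2 : δ ^ 2 ≠ 0 := pow_ne_zero 2 hδ
  have hp2 : U 0 2 = q * (2 * x * z) := by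
    apply mul_right_cancel₀ hδ2
    rw [mul_right_comm q, hq, hδd]
    linear_combination x ^ 2 * hC + z ^ 2 * hA
  have hr2 : U 1 2 = q * (2 * y * w) := by
    apply mul_right_cancel₀ hδ2
    rw [mul_right_comm q, hq, hδd]
    linear_combination y ^ 2 * hC + w ^ 2 * hA
  have hs2 : U 2 2 = q * (x * w + y * z) := by
    apply mul_right_cancel₀ hδ2
    rw [mul_right_comm q, hq, hδd]
    linear_combination x * y * hC + z * w * hA
  have hqq : q ^ 2 = c * c' := by
    apply mul_right_cancel₀ hδ2
    rw [hlam]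
    rw [hp2, hr2, hs2] at h2
    linear_combination -h2
  have hq0 : q ≠ 0 := by
    rintro rfl
    exact mul_ne_zero hc hc' (by rw [← hqq]; ring)
  have hdet : (!![x, y; q / c * z, q / c * w] : Matrix (Fin 2) (Fin 2) K).det ≠ 0 := by
    have : (!![x, y; q / c * z, q / c * w] : Matrix (Fin 2) (Fin 2) K).det = q / c * δ := by
      rw [Matrix.det_fin_two_of, hδd]; ring
    rw [this]
    exact mul_ne_zero (div_ne_zero hq0 hc) hδ
  -- Since `q² = c c'`, the matrix with rows `(x, y)` and `(q / c) (z, w)` scales all three images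
  -- by the same factor `c`.
  refine ⟨Matrix.GeneralLinearGroup.mkOfDetNeZero _ hdet, Units.mk0 c hc, fun y' => ?_⟩
  have hqc : c * (q / c) = q := by field_simp
  have hqc2 : c * (q / c) ^ 2 = c' := by field_simp; exact hqq
  rw [Units.val_mk0]
  change _ = c • (Matrix.transpose !![x, y; q / c * z, q / c * w] * _ *
    !![x, y; q / c * z, q / c * w])
  generalize q / c = g at *
  simp only [Matrix.mulVec, dotProduct, Fin.sum_univ_three]
  rw [hp0, hr0, hs0, hp1, hr1, hs1, hp2, hr2, hs2]
  ext i j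
  fin_cases i <;> fin_cases j <;>
    simp [Matrix.mul_apply, Fin.sum_univ_two] <;> rw [← hqc, ← hqc2] <;> ring

/-- Over a form without vertex, the linear forms of one representation are linear combinations of
those of the other, and the transition map multiplies the determinant by a constant. -/
theorem tripleEquiv_of_isSymmDetRep {F : homogeneousSubmodule (Fin 3) K 2}
    (hvert : HasNoVertex (F : MvPolynomial (Fin 3) K)) {M N : Fin 3 → Matrix (Fin 2) (Fin 2) K}
    (hM : IsSymmDetRep F M) (hN : IsSymmDetRep F N) : TripleEquiv M N := by
  have hdet := det_entryMatrix_ne_zero hvert hM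
  obtain ⟨hMs, a, ha⟩ := hM
  obtain ⟨hNs, b, hb⟩ := hN
  set S := entryMatrix M with hS
  set T := entryMatrix N with hT
  have hSu : IsUnit S.det := isUnit_iff_ne_zero.mpr hdet
  have hfun : ∀ x : Fin 3 → K, (a : K) * ((S.mulVec x) 0 * (S.mulVec x) 1 - (S.mulVec x) 2 ^ 2) =
      b * ((T.mulVec x) 0 * (T.mulVec x) 1 - (T.mulVec x) 2 ^ 2) := by
    intro x
    have h := congrArg (eval x) (ha.symm.trans hb)
    rw [detForm_eq_of_isSymm hMs, detForm_eq_of_isSymm hNs] at h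
    simpa only [map_mul, map_sub, map_pow, eval_C, Matrix.toMvPolynomial_eval_eq_apply] using h
  obtain ⟨P, c, hP⟩ := exists_congruence_of_similitude (T * S⁻¹) (l := (b : K)⁻¹ * a)
    (mul_ne_zero (inv_ne_zero b.ne_zero) a.ne_zero) (by
      intro y
      have h := hfun (S⁻¹.mulVec y)
      rw [Matrix.mulVec_mulVec, Matrix.mul_nonsing_inv _ hSu, Matrix.one_mulVec,
        Matrix.mulVec_mulVec] at h
      rw [mul_assoc, h, inv_mul_cancel_left₀ b.ne_zero])
  refine ⟨P, c, fun i => ?_⟩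
  have h := hP (fun j => S j i)
  have hcol : (T * S⁻¹).mulVec (fun j => S j i) = fun j => T j i := by
    ext j
    have : T * S⁻¹ * S = T := by rw [Matrix.mul_assoc, Matrix.nonsing_inv_mul _ hSu, Matrix.mul_one]
    conv_rhs => rw [← this]
    rfl
  rw [hcol] at h
  have e : ∀ A : Fin 3 → Matrix (Fin 2) (Fin 2) K, (∀ i, (A i).IsSymm) →
      A i = !![entryMatrix A 0 i, entryMatrix A 2 i; entryMatrix A 2 i, entryMatrix A 1 i] := by
    intro A hA
    ext j k
    have := (hA i).apply 0 1
    fin_cases j <;> fin_cases k <;> simp [entryMatrix, this]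
  rw [e M hMs, e N hNs]
  exact h

end Uniqueness

/-! ### Standard affine charts of a projective spectrum over a field -/

section Charts

variable {K : Type u} [Field K] {A : Type u} [CommRing A] [Algebra K A] (𝒜 : ℕ → Submodule K A)
  [GradedAlgebra 𝒜]

/-- The structure map of the ring of the chart `D₊(f)` of `Proj 𝒜` as a `K`-algebra. -/
def baseToAway (f : A) : K →+* HomogeneousLocalization.Away 𝒜 f :=
  (HomogeneousLocalization.fromZeroRingHom 𝒜 _).comp (algebraMap K (𝒜 0))

theorem awayι_projToSpec {f : A} {m : ℕ} (hf : f ∈ 𝒜 m) (hm : 0 < m) :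
    Proj.awayι 𝒜 f hf hm ≫ projToSpec 𝒜 = Spec.map (CommRingCat.ofHom (baseToAway 𝒜 f)) := by
  rw [projToSpec, Proj.awayι_toSpecZero_assoc, ← Spec.map_comp]
  rfl

variable {𝒜}

/-- A ring homomorphism out of `A` that inverts `f`, evaluated on homogeneous fractions. -/
def awayEval {R : Type*} [CommRing R] {f : A} (φ : A →+* R) (hf : IsUnit (φ f)) :
    HomogeneousLocalization.Away 𝒜 f →+* R :=
  (Localization.awayLift φ f hf).comp (algebraMap _ (Localization.Away f))

theorem awayEval_mk_mul {R : Type*} [CommRing R] {f : A} (φ : A →+* R) (hf : IsUnit (φ f))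
    {m : ℕ} (hfm : f ∈ 𝒜 m) (n : ℕ) (a : A) (ha : a ∈ 𝒜 (n • m)) :
    awayEval φ hf (HomogeneousLocalization.Away.mk 𝒜 hfm n a ha) * φ f ^ n = φ a := by
  rw [← map_pow]
  have h1 : ∀ x : A, φ x = Localization.awayLift φ f hf (algebraMap A _ x) :=
    fun x => (IsLocalization.Away.lift_eq f hf x).symm
  rw [h1, h1 a]
  simp only [awayEval, RingHom.comp_apply]
  rw [← map_mul, HomogeneousLocalization.algebraMap_apply, HomogeneousLocalization.Away.val_mk,
    Localization.mk_eq_mk']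
  exact congrArg _ (IsLocalization.mk'_spec _ a (⟨f ^ n, n, rfl⟩ : Submonoid.powers f))

theorem awayEval_baseToAway {R : Type*} [CommRing R] {f : A} (φ : A →+* R) (hf : IsUnit (φ f))
    (c : K) : awayEval φ hf (baseToAway 𝒜 f c) = φ (algebraMap K A c) :=
  IsLocalization.Away.lift_eq f hf _

/-- A morphism from a local scheme `Spec R` to `Proj 𝒜` factors through one of the charts of a
covering family. -/
theorem exists_factor_awayι {R : CommRingCat.{u}} [IsLocalRing R] {ι : Type*} (f : ι → A)
    {m : ι → ℕ} (hf : ∀ i, f i ∈ 𝒜 (m i)) (hm : ∀ i, 0 < m i)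
    (hcov : ⨆ i, Proj.basicOpen 𝒜 (f i) = ⊤) (g : Spec R ⟶ Proj 𝒜) :
    ∃ (i : ι) (φ : HomogeneousLocalization.Away 𝒜 (f i) →+* R),
      g = Spec.map (CommRingCat.ofHom φ) ≫ Proj.awayι 𝒜 (f i) (hf i) (hm i) := by
  obtain ⟨i, hi⟩ := Opens.mem_iSup.mp
    (hcov.ge (Set.mem_univ (g (IsLocalRing.closedPoint R))))
  have hr : Set.range g ⊆ Set.range (Proj.awayι 𝒜 (f i) (hf i) (hm i)) := by
    have h1 := Proj.opensRange_awayι 𝒜 (f i) (hf i) (hm i)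
    have h2 : g ⁻¹ᵁ (Proj.basicOpen 𝒜 (f i)) = ⊤ := (IsLocalRing.closedPoint_mem_iff _).mp hi
    rintro _ ⟨x, rfl⟩
    have h3 : x ∈ g ⁻¹ᵁ (Proj.basicOpen 𝒜 (f i)) := h2.ge (Set.mem_univ x)
    change g x ∈ Proj.basicOpen 𝒜 (f i) at h3
    rw [← h1] at h3
    exact h3
  refine ⟨i, (Spec.preimage (IsOpenImmersion.lift (Proj.awayι 𝒜 (f i) (hf i) (hm i)) g hr)).hom, ?_⟩
  rw [CommRingCat.ofHom_hom, Spec.map_preimage, IsOpenImmersion.lift_fac]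

end Charts

section PlaneCurveCharts

attribute [local instance] MvPolynomial.gradedAlgebra

variable {K : Type u} [Field K] {n : ℕ} (F : homogeneousSubmodule (Fin 3) K n)

/-- The class of the coordinate `Xᵢ` in the homogeneous coordinate ring. -/
def coordX (i : Fin 3) : CoordRing F :=
  Ideal.Quotient.mkₐ K (Ideal.span {(F : MvPolynomial (Fin 3) K)}) (X i)

theorem coordX_mem (i : Fin 3) : coordX F i ∈ coordGrading F 1 :=
  ⟨X i, isHomogeneous_X K i, rfl⟩

theorem aeval_coordX (p : MvPolynomial (Fin 3) K) :
    aeval (coordX F) p = Ideal.Quotient.mkₐ K (Ideal.span {(F : MvPolynomial (Fin 3) K)}) p := by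
  have : aeval (coordX F) = Ideal.Quotient.mkₐ K (Ideal.span {(F : MvPolynomial (Fin 3) K)}) := by
    apply MvPolynomial.algHom_ext; intro i; simp [coordX]
  rw [this]

theorem irrelevant_le_span_coordX : (HomogeneousIdeal.irrelevant (coordGrading F)).toIdeal ≤
    Ideal.span (Set.range (coordX F)) := by
  refine (HomogeneousIdeal.toIdeal_irrelevant_le _).mpr ?_
  rintro (_ | i) hi _ ⟨p, hp, rfl⟩
  · exact absurd hi (lt_irrefl 0)
  have h : p ∈ Ideal.span (Set.range (X : Fin 3 → MvPolynomial (Fin 3) K)) := by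
    have h1 : p ∈ idealOfVars (Fin 3) K ^ 1 := by
      rw [mem_pow_idealOfVars_iff']
      intro d hd
      refine (hp : p.IsHomogeneous (i + 1)).coeff_eq_zero ?_
      omega
    rwa [pow_one] at h1
  have h2 := Ideal.mem_map_of_mem (Ideal.Quotient.mkₐ K
    (Ideal.span {(F : MvPolynomial (Fin 3) K)})) h
  rw [Ideal.map_span, ← Set.range_comp] at h2
  exact h2

theorem iSup_basicOpen_coordX :
    ⨆ i, Proj.basicOpen (coordGrading F) (coordX F i) = ⊤ :=
  Proj.iSup_basicOpen_eq_top _ _ (irrelevant_le_span_coordX F)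

/-- The affine coordinate `Xⱼ / Xᵢ` on the chart `D₊(Xᵢ)` of a plane curve. -/
def coordFrac (i j : Fin 3) : HomogeneousLocalization.Away (coordGrading F) (coordX F i) :=
  HomogeneousLocalization.Away.mk (coordGrading F) (coordX_mem F i) 1 (coordX F j)
    (by rw [one_smul]; exact coordX_mem F j)

theorem coordFrac_self (i : Fin 3) : coordFrac F i i = 1 := by
  apply HomogeneousLocalization.val_injective
  rw [coordFrac, HomogeneousLocalization.Away.val_mk, HomogeneousLocalization.val_one,
    Localization.mk_eq_mk', IsLocalization.mk'_eq_iff_eq_mul]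
  simp

/-- The affine coordinates on a chart satisfy the dehomogenized equation of the curve. -/
theorem eval₂_coordFrac (i : Fin 3) : eval₂ (baseToAway (coordGrading F) (coordX F i))
    (coordFrac F i) (F : MvPolynomial (Fin 3) K) = 0 := by
  apply HomogeneousLocalization.val_injective
  rw [HomogeneousLocalization.val_zero, ← HomogeneousLocalization.algebraMap_apply]
  have hval : algebraMap (HomogeneousLocalization.Away (coordGrading F) (coordX F i))
      (Localization.Away (coordX F i)) (eval₂ (baseToAway (coordGrading F) (coordX F i))
      (coordFrac F i) (F : MvPolynomial (Fin 3) K)) = aeval (fun j =>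
        (Localization.mk 1 ⟨coordX F i, Submonoid.mem_powers _⟩ : Localization.Away (coordX F i)) *
        algebraMap (CoordRing F) _ (coordX F j)) (F : MvPolynomial (Fin 3) K) := by
    rw [← RingHom.coe_coe, hom_eval₂, aeval_def]
    congr 1
    ext j
    simp only [coordFrac]
    rw [RingHom.coe_coe, HomogeneousLocalization.algebraMap_apply,
      HomogeneousLocalization.Away.val_mk, ← Localization.mk_one_eq_algebraMap,
      Localization.mk_mul, one_mul, mul_one]
    simp
  have hmap := comp_aeval_apply (coordX F) (IsScalarTower.toAlgHom K (CoordRing F)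
    (Localization.Away (coordX F i))) (F : MvPolynomial (Fin 3) K)
  rw [aeval_coordX] at hmap
  rw [hval, aeval_mul_of_isHomogeneous F.2]
  have h0 : Ideal.Quotient.mkₐ K (Ideal.span {(F : MvPolynomial (Fin 3) K)}) F = 0 :=
    Ideal.Quotient.eq_zero_iff_mem.mpr (Ideal.mem_span_singleton_self _)
  rw [h0, map_zero] at hmap
  exact (congrArg _ hmap.symm).trans (mul_zero _)

/-- The chart `D₊(Xᵢ)` of a plane curve. -/
def PlaneCurve.chart (i : Fin 3) :
    Spec (.of (HomogeneousLocalization.Away (coordGrading F) (coordX F i))) ⟶ PlaneCurve F :=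
  Proj.awayι (coordGrading F) (coordX F i) (coordX_mem F i) one_pos

instance (i : Fin 3) : IsOpenImmersion (PlaneCurve.chart F i) :=
  inferInstanceAs (IsOpenImmersion (Proj.awayι _ _ _ _))

theorem PlaneCurve.chart_toSpec (i : Fin 3) : PlaneCurve.chart F i ≫ PlaneCurve.toSpec F =
    Spec.map (CommRingCat.ofHom (baseToAway (coordGrading F) (coordX F i))) :=
  awayι_projToSpec _ _ _

/-- The homogeneous coordinates of a point of a plane curve with values in a local ring. -/
theorem PlaneCurve.exists_coordinates {R : CommRingCat.{u}} [IsLocalRing R]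
    (g : Spec R ⟶ PlaneCurve F) (ρ : K →+* R)
    (hg : g ≫ PlaneCurve.toSpec F = Spec.map (CommRingCat.ofHom ρ)) :
    ∃ v : Fin 3 → R, v ≠ 0 ∧ eval₂ ρ v (F : MvPolynomial (Fin 3) K) = 0 := by
  obtain ⟨i, φ, hφ⟩ := exists_factor_awayι (𝒜 := coordGrading F) (coordX F) (coordX_mem F)
    (fun _ => one_pos) (iSup_basicOpen_coordX F) g
  obtain rfl : g = Spec.map (CommRingCat.ofHom φ) ≫ PlaneCurve.chart F i := hφ
  rw [Category.assoc, PlaneCurve.chart_toSpec, ← Spec.map_comp] at hg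
  have hρ := congrArg CommRingCat.Hom.hom (Spec.map_injective hg)
  simp only [CommRingCat.hom_comp, CommRingCat.hom_ofHom] at hρ
  refine ⟨fun j => φ (coordFrac F i j), fun h => ?_, ?_⟩
  · have := congrFun h i
    simp [coordFrac_self] at this
  · have := congrArg φ (eval₂_coordFrac F i)
    rw [hom_eval₂, map_zero, hρ] at this
    exact this

end PlaneCurveCharts

/-! ### Smooth conics have no vertex -/

section SmoothVertex

variable {K : Type u} [Field K]

theorem MvPolynomial.IsHomogeneous.mem_pow_idealOfVars {σ : Type*} {p : MvPolynomial σ K} {n : ℕ}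
    (hp : p.IsHomogeneous n) : p ∈ idealOfVars σ K ^ n := by
  rw [mem_pow_idealOfVars_iff']
  intro d hd
  exact hp.coeff_eq_zero hd.ne

theorem MvPolynomial.IsHomogeneous.eq_zero_of_mem_pow_idealOfVars {σ : Type*}
    {p : MvPolynomial σ K} {n m : ℕ} (hp : p.IsHomogeneous n) (hnm : n < m)
    (h : p ∈ idealOfVars σ K ^ m) : p = 0 := by
  rw [mem_pow_idealOfVars_iff'] at h
  ext d
  by_cases hd : d.degree = n
  · exact h d (hd ▸ hnm)
  · exact hp.coeff_eq_zero hd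

/-- A perturbation of second order changes a quadratic form only to third order. -/
theorem aeval_X_add_sub_mem {F : MvPolynomial (Fin 3) K} (hF : F.IsHomogeneous 2)
    (δ : Fin 3 → MvPolynomial (Fin 3) K) (hδ : ∀ j, δ j ∈ idealOfVars (Fin 3) K ^ 2) :
    aeval (fun j => X j + δ j) F - F ∈ idealOfVars (Fin 3) K ^ 3 := by
  have hX : ∀ j : Fin 3, (X j : MvPolynomial (Fin 3) K) ∈ idealOfVars (Fin 3) K := fun j =>
    Ideal.subset_span ⟨j, rfl⟩
  have h1 : ∀ i j : Fin 3, (X i + δ i) * (X j + δ j) - X i * X j ∈ idealOfVars (Fin 3) K ^ 3 := by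
    intro i j
    have e : (X i + δ i) * (X j + δ j) - X i * X j = δ j * X i + δ i * X j + δ i * δ j := by ring
    rw [e]
    refine add_mem (add_mem ?_ ?_) ?_
    · rw [pow_succ]; exact Ideal.mul_mem_mul (hδ j) (hX i)
    · rw [pow_succ]; exact Ideal.mul_mem_mul (hδ i) (hX j)
    · rw [pow_succ]; exact Ideal.mul_mem_mul (hδ i) (Ideal.pow_le_self two_ne_zero (hδ j))
  obtain ⟨a, b, c, d, e, f, rfl⟩ := exists_coeff_of_isHomogeneous_two hF
  have h2 := add_mem (add_mem (add_mem (add_mem (add_mem (Ideal.mul_mem_left _ (C a) (h1 0 0))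
    (Ideal.mul_mem_left _ (C b) (h1 1 1))) (Ideal.mul_mem_left _ (C c) (h1 2 2)))
    (Ideal.mul_mem_left _ (C d) (h1 0 1))) (Ideal.mul_mem_left _ (C e) (h1 0 2)))
    (Ideal.mul_mem_left _ (C f) (h1 1 2))
  convert h2 using 1
  simp only [map_add, map_mul, map_pow, aeval_X, aeval_C, algebraMap_eq]
  ring

variable {F : homogeneousSubmodule (Fin 3) K 2}

theorem smooth_baseToAway (hs : Smooth (PlaneCurve.toSpec F)) (i : Fin 3) :
    (baseToAway (coordGrading F) (coordX F i)).Smooth := by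
  have h : Smooth (PlaneCurve.chart F i ≫ PlaneCurve.toSpec F) := inferInstance
  rw [PlaneCurve.chart_toSpec] at h
  exact (HasRingHomProperty.Spec_iff (P := @Smooth)).mp h

/-- A smooth conic has no vertex. If `F (X + v) = F (X)`, then `X ↦ v + X` is a point of the
conic modulo the square of the ideal `(X₀, X₁, X₂)`. By formal smoothness it lifts to a point
modulo the cube, of the form `v + X + δ` with `δ` in the square of the ideal. But
`F (v + X + δ) = F (X + δ)` is congruent to `F` modulo the cube, so that `F = 0`. -/
theorem hasNoVertex_of_smooth (hF : F ≠ 0) (hs : Smooth (PlaneCurve.toSpec F)) :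
    HasNoVertex (F : MvPolynomial (Fin 3) K) := by
  intro v hvF
  by_contra hv
  obtain ⟨i, hi⟩ : ∃ i, v i ≠ 0 := by
    by_contra! h; exact hv (funext h)
  set I := idealOfVars (Fin 3) K with hI
  let π₂ := Ideal.Quotient.mkₐ K (I ^ 2)
  let π₃ := Ideal.Quotient.mkₐ K (I ^ 3)
  let f : MvPolynomial (Fin 3) K ⧸ I ^ 3 →ₐ[K] MvPolynomial (Fin 3) K ⧸ I ^ 2 :=
    Ideal.Quotient.factorₐ K (Ideal.pow_le_pow_right (by norm_num))
  have hf : ∀ p, f (π₃ p) = π₂ p := fun p => rfl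
  have hfs : Function.Surjective f :=
    Ideal.Quotient.factor_surjective (Ideal.pow_le_pow_right (by norm_num))
  have hfker : IsNilpotent (RingHom.ker (f : MvPolynomial (Fin 3) K ⧸ I ^ 3 →+*
      MvPolynomial (Fin 3) K ⧸ I ^ 2)) := by
    refine ⟨2, ?_⟩
    rw [Ideal.zero_eq_bot, eq_bot_iff]
    refine (pow_two (RingHom.ker (f : MvPolynomial (Fin 3) K ⧸ I ^ 3 →+*
      MvPolynomial (Fin 3) K ⧸ I ^ 2))).le.trans (Ideal.mul_le.mpr ?_)
    intro x hx y hy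
    obtain ⟨x, rfl⟩ := Ideal.Quotient.mk_surjective x
    obtain ⟨y, rfl⟩ := Ideal.Quotient.mk_surjective y
    have hx' : x ∈ I ^ 2 := Ideal.Quotient.eq_zero_iff_mem.mp hx
    have hy' : y ∈ I ^ 2 := Ideal.Quotient.eq_zero_iff_mem.mp hy
    rw [Ideal.mem_bot, ← map_mul, Ideal.Quotient.eq_zero_iff_mem, pow_succ]
    exact Ideal.mul_mem_mul hx' (Ideal.pow_le_self two_ne_zero hy')
  -- The point of the conic modulo `I ^ 2`.
  let φ : CoordRing F →ₐ[K] MvPolynomial (Fin 3) K ⧸ I ^ 2 :=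
    Ideal.Quotient.liftₐ _ (π₂.comp (aeval fun j => X j + C (v j))) (by
      intro a ha
      obtain ⟨b, rfl⟩ := Ideal.mem_span_singleton.mp ha
      rw [map_mul, AlgHom.comp_apply, hvF]
      have : π₂ F = 0 := Ideal.Quotient.eq_zero_iff_mem.mpr (IsHomogeneous.mem_pow_idealOfVars F.2)
      rw [this, zero_mul])
  have hφX : ∀ j, φ (coordX F j) = π₂ (X j + C (v j)) := fun j => by
    change π₂ (aeval _ (X j)) = _
    rw [aeval_X]
  have hunit : IsUnit (φ.toRingHom (coordX F i)) := by
    change IsUnit (φ (coordX F i))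
    rw [hφX, map_add]
    refine IsNilpotent.isUnit_add_right_of_commute (r := π₂ (X i)) ⟨2, ?_⟩ ?_ (Commute.all _ _)
    · rw [← map_pow]
      exact Ideal.Quotient.eq_zero_iff_mem.mpr
        (Ideal.pow_mem_pow (I := I) (Ideal.subset_span (Set.mem_range_self i)) 2)
    · exact ((isUnit_iff_ne_zero.mpr hi).map C).map π₂
  let alg : Algebra K (HomogeneousLocalization.Away (coordGrading F) (coordX F i)) :=
    (baseToAway (coordGrading F) (coordX F i)).toAlgebra
  have hsm : Algebra.Smooth K (HomogeneousLocalization.Away (coordGrading F) (coordX F i)) :=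
    smooth_baseToAway hs i
  let g : HomogeneousLocalization.Away (coordGrading F) (coordX F i) →ₐ[K]
      MvPolynomial (Fin 3) K ⧸ I ^ 2 :=
    { awayEval φ.toRingHom hunit with
      commutes' := fun c => (awayEval_baseToAway φ.toRingHom hunit c).trans (φ.commutes c) }
  let G := Algebra.FormallySmooth.liftOfSurjective g f hfs hfker
  have hG : ∀ x, f (G x) = g x := Algebra.FormallySmooth.liftOfSurjective_apply g f hfs hfker
  -- The coordinates of the lift, rescaled by `w = vᵢ + Xᵢ`.
  set w : MvPolynomial (Fin 3) K := X i + C (v i) with hw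
  choose z hz using fun j => Ideal.Quotient.mkₐ_surjective K (I ^ 3) (G (coordFrac F i j))
  have hzF : π₃ (aeval z (F : MvPolynomial (Fin 3) K)) = 0 := by
    have h := congrArg G (eval₂_coordFrac F i)
    rw [map_zero] at h
    rw [comp_aeval_apply, ← h]
    refine Eq.trans ?_ (comp_aeval_apply (coordFrac F i) G (F : MvPolynomial (Fin 3) K)).symm
    exact congrArg (fun t => aeval t (F : MvPolynomial (Fin 3) K)) (funext hz)
  have hδ : ∀ j, w * z j - (X j + C (v j)) ∈ I ^ 2 := by
    intro j
    have h1 := awayEval_mk_mul (𝒜 := coordGrading F) φ.toRingHom hunit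
      (coordX_mem F i) 1 (coordX F j) (by rw [one_smul]; exact coordX_mem F j)
    have h2 : g (coordFrac F i j) * φ (coordX F i) = φ (coordX F j) := by
      rw [pow_one] at h1; exact h1
    rw [← hG, ← hz, hφX, hφX] at h2
    rw [← Ideal.Quotient.eq_zero_iff_mem]
    change π₂ _ = 0
    rw [map_sub, map_mul, sub_eq_zero, mul_comm]
    exact h2
  have h1 : aeval (fun j => w * z j) (F : MvPolynomial (Fin 3) K) ∈ I ^ 3 := by
    rw [aeval_mul_of_isHomogeneous F.2]
    exact Ideal.mul_mem_left _ _ (Ideal.Quotient.eq_zero_iff_mem.mp hzF)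
  have h2 : aeval (fun j => w * z j) (F : MvPolynomial (Fin 3) K) =
      aeval (fun j => X j + (w * z j - (X j + C (v j)))) (F : MvPolynomial (Fin 3) K) := by
    conv_rhs => rw [← hvF]
    rw [comp_aeval_apply]
    congr 2
    ext1 j
    simp only [map_add, aeval_X, aeval_C, algebraMap_eq]
    ring
  rw [h2] at h1
  have h3 := sub_mem h1 (aeval_X_add_sub_mem F.2 _ hδ)
  rw [sub_sub_cancel] at h3
  exact hF (Subtype.ext (IsHomogeneous.eq_zero_of_mem_pow_idealOfVars F.2 (by norm_num) h3))

end SmoothVertex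

/-! ### Gluing isomorphisms of projective spectra and Veronese maps -/

section ProjGlue

open HomogeneousLocalization

variable {A B : Type u} [CommRing A] [CommRing B] {σ τ : Type u} [SetLike σ A] [SetLike τ B]
  [AddSubgroupClass σ A] [AddSubgroupClass τ B]
  (𝒜 : ℕ → σ) [GradedRing 𝒜] (ℬ : ℕ → τ) [GradedRing ℬ] {ι : Type}

/-- The affine open cover of `Proj 𝒜` by the charts `D₊(fᵢ)`. -/
def projCover (f : ι → A) {m : ι → ℕ} (hf : ∀ i, f i ∈ 𝒜 (m i)) (hm : ∀ i, 0 < m i)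
    (hcov : ⨆ i, Proj.basicOpen 𝒜 (f i) = ⊤) : (Proj 𝒜).AffineOpenCover where
  I₀ := ι
  X i := .of (Away 𝒜 (f i))
  f i := Proj.awayι 𝒜 (f i) (hf i) (hm i)
  idx x := (Opens.mem_iSup.mp (hcov.ge (Set.mem_univ x))).choose
  covers x := by
    change x ∈ (Proj.awayι 𝒜 _ _ _).opensRange
    rw [Proj.opensRange_awayι]
    exact (Opens.mem_iSup.mp (hcov.ge (Set.mem_univ x))).choose_spec

variable {𝒜 ℬ}

/-- Compatible ring homomorphisms between the rings of the charts and of their intersections glue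
to a morphism of projective spectra. -/
theorem exists_proj_hom {f : ι → A} {m : ι → ℕ} (hf : ∀ i, f i ∈ 𝒜 (m i)) (hm : ∀ i, 0 < m i)
    (hcov : ⨆ i, Proj.basicOpen 𝒜 (f i) = ⊤) {g : ι → B} {n : ι → ℕ}
    (hg : ∀ i, g i ∈ ℬ (n i)) (hn : ∀ i, 0 < n i)
    {ff : ι → ι → A} (hff : ∀ i j, ff i j = f i * f j)
    {gg : ι → ι → B} (hgg : ∀ i j, gg i j = g i * g j)
    (β : ∀ i, Away ℬ (g i) →+* Away 𝒜 (f i)) (γ : ∀ i j, Away ℬ (gg i j) →+* Away 𝒜 (ff i j))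
    (hl : ∀ i j, (γ i j).comp (awayMap ℬ (hg j) (hgg i j)) =
      (awayMap 𝒜 (hf j) (hff i j)).comp (β i))
    (hr : ∀ i j, (γ i j).comp (awayMap ℬ (hg i) ((hgg i j).trans (mul_comm _ _))) =
      (awayMap 𝒜 (hf i) ((hff i j).trans (mul_comm _ _))).comp (β j)) :
    ∃ φ : Proj 𝒜 ⟶ Proj ℬ, ∀ i, Proj.awayι 𝒜 (f i) (hf i) (hm i) ≫ φ =
      Spec.map (CommRingCat.ofHom (β i)) ≫ Proj.awayι ℬ (g i) (hg i) (hn i) := by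
  have key : ∀ i j : ι, Limits.pullback.fst (Proj.awayι 𝒜 (f i) (hf i) (hm i))
      (Proj.awayι 𝒜 (f j) (hf j) (hm j)) ≫ Spec.map (CommRingCat.ofHom (β i)) ≫
        Proj.awayι ℬ (g i) (hg i) (hn i) = Limits.pullback.snd _ _ ≫
          Spec.map (CommRingCat.ofHom (β j)) ≫ Proj.awayι ℬ (g j) (hg j) (hn j) := by
    intro i j
    rw [← Proj.pullbackAwayιIso_hom_SpecMap_awayMap_left 𝒜 (hf i) (hm i) (hf j) (hm j) (hff i j),
      ← Proj.pullbackAwayιIso_hom_SpecMap_awayMap_right 𝒜 (hf i) (hm i) (hf j) (hm j) (hff i j),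
      Category.assoc, Category.assoc]
    congr 1
    rw [← Category.assoc, ← Category.assoc, ← Spec.map_comp, ← Spec.map_comp,
      ← CommRingCat.ofHom_comp, ← CommRingCat.ofHom_comp, ← hl, ← hr, CommRingCat.ofHom_comp,
      CommRingCat.ofHom_comp, Spec.map_comp, Spec.map_comp, Category.assoc, Category.assoc,
      Proj.SpecMap_awayMap_awayι, Proj.SpecMap_awayMap_awayι]
    rfl
  exact ⟨(projCover 𝒜 f hf hm hcov).openCover.glueMorphisms
    (fun i : ι => Spec.map (CommRingCat.ofHom (β i)) ≫ Proj.awayι ℬ (g i) (hg i) (hn i)) key,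
    fun i => (projCover 𝒜 f hf hm hcov).openCover.ι_glueMorphisms _ _ i⟩

/-- Compatible isomorphisms between the rings of the charts and of their intersections glue to an
isomorphism of projective spectra. -/
theorem exists_proj_iso {f : ι → A} {m : ι → ℕ} (hf : ∀ i, f i ∈ 𝒜 (m i)) (hm : ∀ i, 0 < m i)
    (hcov : ⨆ i, Proj.basicOpen 𝒜 (f i) = ⊤) {g : ι → B} {n : ι → ℕ}
    (hg : ∀ i, g i ∈ ℬ (n i)) (hn : ∀ i, 0 < n i)
    (hcov' : ⨆ i, Proj.basicOpen ℬ (g i) = ⊤)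
    {ff : ι → ι → A} (hff : ∀ i j, ff i j = f i * f j)
    {gg : ι → ι → B} (hgg : ∀ i j, gg i j = g i * g j)
    (β : ∀ i, Away ℬ (g i) ≃+* Away 𝒜 (f i)) (γ : ∀ i j, Away ℬ (gg i j) ≃+* Away 𝒜 (ff i j))
    (hl : ∀ i j, (γ i j : _ →+* _).comp (awayMap ℬ (hg j) (hgg i j)) =
      (awayMap 𝒜 (hf j) (hff i j)).comp (β i : _ →+* _))
    (hr : ∀ i j, (γ i j : _ →+* _).comp (awayMap ℬ (hg i) ((hgg i j).trans (mul_comm _ _))) =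
      (awayMap 𝒜 (hf i) ((hff i j).trans (mul_comm _ _))).comp (β j : _ →+* _)) :
    ∃ φ : Proj 𝒜 ≅ Proj ℬ, ∀ i, Proj.awayι 𝒜 (f i) (hf i) (hm i) ≫ φ.hom =
      Spec.map (CommRingCat.ofHom (β i : _ →+* _)) ≫ Proj.awayι ℬ (g i) (hg i) (hn i) := by
  obtain ⟨φ, hφ⟩ := exists_proj_hom hf hm hcov hg hn hff hgg (fun i => (β i : _ →+* _))
    (fun i j => (γ i j : _ →+* _)) hl hr
  obtain ⟨χ, hχ⟩ := exists_proj_hom hg hn hcov' hf hm hgg hff (fun i => ((β i).symm : _ →+* _))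
    (fun i j => ((γ i j).symm : _ →+* _))
    (fun i j => by
      ext1 x
      obtain ⟨y, rfl⟩ := (β i).surjective x
      have := DFunLike.congr_fun (hl i j) y
      simp only [RingHom.comp_apply, RingHom.coe_coe] at this
      simp only [RingHom.comp_apply, RingHom.coe_coe]
      rw [← this, RingEquiv.symm_apply_apply, RingEquiv.symm_apply_apply])
    (fun i j => by
      ext1 x
      obtain ⟨y, rfl⟩ := (β j).surjective x
      have := DFunLike.congr_fun (hr i j) y
      simp only [RingHom.comp_apply, RingHom.coe_coe] at this
      simp only [RingHom.comp_apply, RingHom.coe_coe]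
      rw [← this, RingEquiv.symm_apply_apply, RingEquiv.symm_apply_apply])
  have h1 : ∀ i : ι, Proj.awayι 𝒜 (f i) (hf i) (hm i) ≫ φ ≫ χ =
      Proj.awayι 𝒜 (f i) (hf i) (hm i) ≫ 𝟙 _ := fun i => by
    rw [reassoc_of% (hφ i), hχ, ← Category.assoc, ← Spec.map_comp, ← CommRingCat.ofHom_comp]
    simp
  have h2 : ∀ i : ι, Proj.awayι ℬ (g i) (hg i) (hn i) ≫ χ ≫ φ =
      Proj.awayι ℬ (g i) (hg i) (hn i) ≫ 𝟙 _ := fun i => by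
    rw [reassoc_of% (hχ i), hφ, ← Category.assoc, ← Spec.map_comp, ← CommRingCat.ofHom_comp]
    simp
  exact ⟨⟨φ, χ, (projCover 𝒜 f hf hm hcov).openCover.hom_ext _ _ h1,
    (projCover ℬ g hg hn hcov').openCover.hom_ext _ _ h2⟩, hφ⟩

end ProjGlue

section Veronese

open HomogeneousLocalization

variable {A B : Type u} [CommRing A] [CommRing B] {σ τ : Type u} [SetLike σ A] [SetLike τ B]
  [AddSubgroupClass σ A] [AddSubgroupClass τ B]
  {𝒜 : ℕ → σ} [GradedRing 𝒜] {ℬ : ℕ → τ} [GradedRing ℬ] {d : ℕ} {ψ : A →+* B}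

/-- The map on localizations induced by `ψ`. -/
def locMap (ψ : A →+* B) (f : A) : Localization.Away f →+* Localization.Away (ψ f) :=
  IsLocalization.map (Localization.Away (ψ f)) ψ (M := Submonoid.powers f)
    (T := Submonoid.powers (ψ f)) (by rintro _ ⟨n, rfl⟩; exact ⟨n, by simp⟩)

/-- The map on degree zero fractions induced by a ring homomorphism `ψ` that multiplies degrees
by `d`. -/
def veroneseAway (hψ : ∀ i, ∀ a ∈ 𝒜 i, ψ a ∈ ℬ (d * i)) (f : A) : Away 𝒜 f →+* Away ℬ (ψ f) :=
  have hval : ∀ x : NumDenSameDeg 𝒜 (Submonoid.powers f),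
      (HomogeneousLocalization.mk (𝒜 := ℬ) (x := Submonoid.powers (ψ f)) ⟨d * x.deg,
        ⟨ψ x.num, hψ _ _ x.num.2⟩, ⟨ψ x.den, hψ _ _ x.den.2⟩, by
          obtain ⟨n, hn⟩ := x.den_mem; exact ⟨n, by simp [← hn]⟩⟩).val =
      locMap ψ f (HomogeneousLocalization.mk x).val := by
    intro x
    rw [val_mk, val_mk, locMap, Localization.mk_eq_mk', Localization.mk_eq_mk',
      IsLocalization.map_mk']
  let F : Away 𝒜 f → Away ℬ (ψ f) := Quotient.lift (fun x : NumDenSameDeg 𝒜 (Submonoid.powers f) =>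
      HomogeneousLocalization.mk (𝒜 := ℬ) (x := Submonoid.powers (ψ f)) ⟨d * x.deg,
        ⟨ψ x.num, hψ _ _ x.num.2⟩, ⟨ψ x.den, hψ _ _ x.den.2⟩, by
          obtain ⟨n, hn⟩ := x.den_mem; exact ⟨n, by simp [← hn]⟩⟩) (by
    intro x y hxy
    apply val_injective
    simp only [hval]
    exact congrArg _ hxy)
  have hF : ∀ x, (F x).val = locMap ψ f x.val := fun x => by
    obtain ⟨c, rfl⟩ := mk_surjective x
    exact hval c
  { toFun := F
    map_one' := val_injective _ (by rw [hF, val_one, map_one, val_one])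
    map_zero' := val_injective _ (by rw [hF, val_zero, map_zero, val_zero])
    map_mul' := fun x y => val_injective _ (by rw [hF, val_mul, map_mul, val_mul, hF, hF])
    map_add' := fun x y => val_injective _ (by rw [hF, val_add, map_add, val_add, hF, hF]) }

variable (hψ : ∀ i, ∀ a ∈ 𝒜 i, ψ a ∈ ℬ (d * i))

theorem veroneseAway_mk {f : A} {m : ℕ} (hf : f ∈ 𝒜 m) (n : ℕ) (a : A) (ha : a ∈ 𝒜 (n • m)) :
    veroneseAway hψ f (Away.mk 𝒜 hf n a ha) = Away.mk ℬ (hψ _ _ hf) n (ψ a)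
      (by have := hψ _ _ ha; rwa [smul_eq_mul, Nat.mul_left_comm] at this) := by
  apply val_injective
  rw [Away.val_mk]
  change Localization.mk _ _ = _
  congr 1
  exact Subtype.ext (map_pow ψ f n)

theorem veroneseAway_bijective (hinj : ∀ i, ∀ a ∈ 𝒜 i, ψ a = 0 → a = 0)
    (hsurj : ∀ i, ∀ b ∈ ℬ (d * i), ∃ a ∈ 𝒜 i, ψ a = b) {f : A} {m : ℕ} (hf : f ∈ 𝒜 m) :
    Function.Bijective (veroneseAway hψ f) := by
  constructor
  · rw [injective_iff_map_eq_zero]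
    intro x hx
    obtain ⟨n, a, ha, rfl⟩ := Away.mk_surjective 𝒜 hf x
    rw [veroneseAway_mk] at hx
    replace hx := congrArg HomogeneousLocalization.val hx
    rw [Away.val_mk, val_zero, Localization.mk_eq_mk', IsLocalization.mk'_eq_zero_iff] at hx
    obtain ⟨⟨_, k, rfl⟩, hk⟩ := hx
    apply val_injective
    rw [Away.val_mk, val_zero, Localization.mk_eq_mk', IsLocalization.mk'_eq_zero_iff]
    refine ⟨⟨_, k, rfl⟩, ?_⟩
    refine hinj (k • m + n • m) _ (SetLike.mul_mem_graded (SetLike.pow_mem_graded k hf) ha) ?_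
    rw [map_mul, map_pow]
    exact hk
  · intro y
    obtain ⟨n, b, hb, rfl⟩ := Away.mk_surjective ℬ (hψ _ _ hf) y
    obtain ⟨a, ha, rfl⟩ := hsurj (n • m) b (by rwa [smul_eq_mul, Nat.mul_left_comm])
    exact ⟨Away.mk 𝒜 hf n a ha, veroneseAway_mk hψ hf n a ha⟩

theorem veroneseAway_comp_awayMap {f g x : A} {m m' : ℕ} (hf : f ∈ 𝒜 m) (hg : g ∈ 𝒜 m')
    (hx : x = f * g) (hx' : ψ x = ψ f * ψ g) :
    (veroneseAway hψ x).comp (awayMap 𝒜 hg hx) =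
      (awayMap ℬ (hψ _ _ hg) hx').comp (veroneseAway hψ f) := by
  ext1 y
  obtain ⟨n, a, ha, rfl⟩ := Away.mk_surjective 𝒜 hf y
  rw [RingHom.comp_apply, RingHom.comp_apply, awayMap_mk, veroneseAway_mk, veroneseAway_mk,
    awayMap_mk]
  apply val_injective
  rw [Away.val_mk, Away.val_mk, map_mul, map_pow]

/-- The Veronese isomorphism: a ring homomorphism identifying `𝒜 i` with `ℬ (d * i)` for all `i`
induces an isomorphism `Proj ℬ ≅ Proj 𝒜`, given on charts by `veroneseAway`. -/
theorem exists_veronese_iso (hd : 0 < d) (hinj : ∀ i, ∀ a ∈ 𝒜 i, ψ a = 0 → a = 0)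
    (hsurj : ∀ i, ∀ b ∈ ℬ (d * i), ∃ a ∈ 𝒜 i, ψ a = b) {ι : Type} {f : ι → A} {m : ι → ℕ}
    (hf : ∀ i, f i ∈ 𝒜 (m i)) (hm : ∀ i, 0 < m i)
    (hcov : ⨆ i, Proj.basicOpen 𝒜 (f i) = ⊤) (hcov' : ⨆ i, Proj.basicOpen ℬ (ψ (f i)) = ⊤) :
    ∃ φ : Proj ℬ ≅ Proj 𝒜, ∀ i,
      Proj.awayι ℬ (ψ (f i)) (hψ _ _ (hf i)) (Nat.mul_pos hd (hm i)) ≫ φ.hom =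
      Spec.map (CommRingCat.ofHom (veroneseAway hψ (f i))) ≫
        Proj.awayι 𝒜 (f i) (hf i) (hm i) :=
  exists_proj_iso (f := fun i => ψ (f i)) (fun i => hψ _ _ (hf i))
    (fun i => Nat.mul_pos hd (hm i)) hcov' hf hm hcov
    (ff := fun i j => ψ (f i * f j)) (fun _ _ => map_mul ψ _ _)
    (gg := fun i j => f i * f j) (fun _ _ => rfl)
    (fun i => RingEquiv.ofBijective _ (veroneseAway_bijective hψ hinj hsurj (hf i)))
    (fun i j => RingEquiv.ofBijective _ (veroneseAway_bijective hψ hinj hsurj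
      (SetLike.mul_mem_graded (hf i) (hf j))))
    (fun i j => veroneseAway_comp_awayMap hψ (hf i) (hf j) _ _)
    (fun i j => veroneseAway_comp_awayMap hψ (hf j) (hf i) _ _)

end Veronese

/-! ### The parametrization of a conic with a symmetric determinantal representation -/

section Parametrization

attribute [local instance] MvPolynomial.gradedAlgebra

variable {K : Type u} [Field K]

/-- The quadratic parametrization `(s², t², st)` of the conic `X₀X₁ = X₂²`. -/
def quadParam : Fin 3 → MvPolynomial (Fin 2) K := ![X 0 ^ 2, X 1 ^ 2, X 0 * X 1]

theorem isHomogeneous_quadParam (k : Fin 3) :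
    (quadParam k : MvPolynomial (Fin 2) K).IsHomogeneous 2 := by
  fin_cases k
  · exact isHomogeneous_X_pow 0 2
  · exact isHomogeneous_X_pow 1 2
  · exact (isHomogeneous_X K 0).mul (isHomogeneous_X K 1)

/-- Modulo `X₀X₁ - X₂²` every polynomial has degree at most one in `X₂`. -/
theorem exists_dvd_sub_rename (p : MvPolynomial (Fin 3) K) :
    ∃ a b : MvPolynomial (Fin 2) K, (X 0 * X 1 - X 2 ^ 2 : MvPolynomial (Fin 3) K) ∣
      p - (rename ![0, 1] a + X 2 * rename ![0, 1] b) := by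
  induction p using MvPolynomial.induction_on with
  | C c => exact ⟨C c, 0, by simp⟩
  | add p q hp hq =>
    obtain ⟨a, b, r, h⟩ := hp
    obtain ⟨a', b', r', h'⟩ := hq
    exact ⟨a + a', b + b', r + r', by rw [map_add, map_add]; linear_combination h + h'⟩
  | mul_X p i hp =>
    obtain ⟨a, b, r, h⟩ := hp
    fin_cases i
    · refine ⟨a * X 0, b * X 0, r * X 0, ?_⟩
      simp only [map_mul, rename_X, Matrix.cons_val, Fin.zero_eta]
      linear_combination X 0 * h
    · refine ⟨a * X 1, b * X 1, r * X 1, ?_⟩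
      simp only [map_mul, rename_X, Matrix.cons_val, Fin.mk_one]
      linear_combination X 1 * h
    · refine ⟨X 0 * X 1 * b, a, r * X 2 - rename ![0, 1] b, ?_⟩
      simp only [map_mul, rename_X, Matrix.cons_val, Fin.reduceFinMk]
      linear_combination X 2 * h

/-- The monomials of `a (s², t²)` have even exponents, those of `s t b (s², t²)` odd exponents. -/
theorem eq_zero_of_expand_add {a b : MvPolynomial (Fin 2) K}
    (h : expand 2 a + X 0 * X 1 * expand 2 b = 0) : a = 0 ∧ b = 0 := by
  have ha : a = 0 := by
    ext m
    have h1 := congrArg (coeff (2 • m)) h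
    rw [coeff_add, coeff_expand_smul 2 two_ne_zero, mul_assoc, coeff_X_mul', coeff_zero] at h1
    split_ifs at h1 with h2
    · rw [coeff_X_mul'] at h1
      split_ifs at h1 with h3
      · rw [coeff_expand_of_not_dvd (i := 0), add_zero] at h1
        · simpa using h1
        · have : (2 • m) 0 ≠ 0 := Finsupp.mem_support_iff.mp h2
          simp at this ⊢
          omega
      · simpa using h1
    · simpa using h1
  refine ⟨ha, ?_⟩
  rw [ha, map_zero, zero_add] at h
  have h0 : (X 0 * X 1 : MvPolynomial (Fin 2) K) ≠ 0 := mul_ne_zero (X_ne_zero 0) (X_ne_zero 1)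
  exact (expand_eq_zero two_pos).mp ((mul_eq_zero.mp h).resolve_left h0)

/-- The kernel of the parametrization is generated by `X₀X₁ - X₂²`. -/
theorem dvd_of_aeval_quadParam_eq_zero {p : MvPolynomial (Fin 3) K}
    (hp : aeval (quadParam : Fin 3 → MvPolynomial (Fin 2) K) p = 0) :
    (X 0 * X 1 - X 2 ^ 2 : MvPolynomial (Fin 3) K) ∣ p := by
  obtain ⟨a, b, hab⟩ := exists_dvd_sub_rename p
  have hr : ∀ c : MvPolynomial (Fin 2) K,
      aeval (quadParam : Fin 3 → MvPolynomial (Fin 2) K) (rename ![0, 1] c) = expand 2 c := by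
    intro c
    rw [aeval_rename]
    have : aeval (quadParam ∘ ![0, 1]) = (expand 2 : MvPolynomial (Fin 2) K →ₐ[K] _) := by
      apply MvPolynomial.algHom_ext
      intro i
      fin_cases i <;> simp [quadParam]
    rw [this]
  have h : expand 2 a + X 0 * X 1 * expand 2 b = 0 := by
    obtain ⟨r, hr'⟩ := hab
    have h1 := congrArg (aeval (quadParam : Fin 3 → MvPolynomial (Fin 2) K)) hr'
    simp only [map_sub, map_add, map_mul, map_pow, hr, hp, aeval_X] at h1
    simp only [quadParam, Matrix.cons_val] at h1
    linear_combination -h1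
  obtain ⟨rfl, rfl⟩ := eq_zero_of_expand_add h
  simpa using hab

/-- Every form of even degree `2i` in `s, t` is a form of degree `i` in `s², t², st`. -/
theorem exists_aeval_quadParam_eq {i : ℕ} {b : MvPolynomial (Fin 2) K}
    (hb : b.IsHomogeneous (2 * i)) : ∃ p : MvPolynomial (Fin 3) K, p.IsHomogeneous i ∧
      aeval (quadParam : Fin 3 → MvPolynomial (Fin 2) K) p = b := by
  suffices h : b ∈ (homogeneousSubmodule (Fin 3) K i).map
      (aeval (quadParam : Fin 3 → MvPolynomial (Fin 2) K)).toLinearMap by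
    obtain ⟨p, hp, h⟩ := h
    exact ⟨p, hp, h⟩
  rw [b.as_sum]
  refine Submodule.sum_mem _ fun m hm => ?_
  have hdeg : m 0 + m 1 = 2 * i := by
    rw [← hb (mem_support_iff.mp hm), Finsupp.weight_apply, Finsupp.sum_fintype _ _ (by simp)]
    simp
  have hmon : monomial m (coeff m b) = C (coeff m b) * (X 0 ^ m 0 * X 1 ^ m 1) := by
    rw [monomial_eq, Finsupp.prod_fintype _ _ (by simp), Fin.prod_univ_two]
  rw [hmon]
  rcases Nat.even_or_odd' (m 0) with ⟨k, hk | hk⟩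
  · refine ⟨C (coeff m b) * (X 0 ^ k * X 1 ^ (i - k)), ?_, ?_⟩
    · have := (((isHomogeneous_X_pow (R := K) (0 : Fin 3) k).mul
        (isHomogeneous_X_pow (R := K) (1 : Fin 3) (i - k)))).C_mul (coeff m b)
      rwa [show k + (i - k) = i by omega] at this
    · simp only [AlgHom.toLinearMap_apply, map_mul, map_pow, aeval_X, aeval_C, algebraMap_eq]
      simp only [quadParam, Matrix.cons_val]
      rw [← pow_mul, ← pow_mul, hk, show m 1 = 2 * (i - k) by omega]
  · refine ⟨C (coeff m b) * (X 0 ^ k * X 1 ^ (i - k - 1) * X 2), ?_, ?_⟩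
    · have := ((((isHomogeneous_X_pow (R := K) (0 : Fin 3) k).mul
        (isHomogeneous_X_pow (R := K) (1 : Fin 3) (i - k - 1)))).mul
        (isHomogeneous_X K 2)).C_mul (coeff m b)
      rwa [show k + (i - k - 1) + 1 = i by omega] at this
    · simp only [AlgHom.toLinearMap_apply, map_mul, map_pow, aeval_X, aeval_C, algebraMap_eq]
      simp only [quadParam, Matrix.cons_val]
      rw [← pow_mul, ← pow_mul, hk, show m 1 = 2 * (i - k - 1) + 1 by omega]
      ring

theorem irrelevant_le_span_X :
    (HomogeneousIdeal.irrelevant (homogeneousSubmodule (Fin 2) K)).toIdeal ≤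
    Ideal.span (Set.range (X : Fin 2 → MvPolynomial (Fin 2) K)) := by
  refine (HomogeneousIdeal.toIdeal_irrelevant_le _).mpr ?_
  rintro i hi p hp
  have h1 : p ∈ idealOfVars (Fin 2) K ^ 1 :=
    Ideal.pow_le_pow_right hi (IsHomogeneous.mem_pow_idealOfVars hp)
  rwa [pow_one] at h1

/-- A conic with equation `a (l₀ l₁ - l₂²)` in independent linear forms `lᵢ` is isomorphic to the
projective line over `K`: the parametrization `lᵢ ↦ (s², t², st)` identifies its homogeneous
coordinate ring with the even part of `K[s, t]`. -/
theorem exists_iso_projectiveLine (F : homogeneousSubmodule (Fin 3) K 2)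
    {S : Matrix (Fin 3) (Fin 3) K} (hS : S.det ≠ 0) {a : K} (ha : a ≠ 0)
    (hFS : (F : MvPolynomial (Fin 3) K) =
      C a * (S.toMvPolynomial 0 * S.toMvPolynomial 1 - S.toMvPolynomial 2 ^ 2)) :
    ∃ φ : PlaneCurve F ≅ ProjectiveLine K,
      φ.hom ≫ ProjectiveLine.toSpec K = PlaneCurve.toSpec F := by
  have hSu : IsUnit S.det := isUnit_iff_ne_zero.mpr hS
  set T := S⁻¹ with hT
  set q : Fin 3 → MvPolynomial (Fin 2) K := fun j => aeval quadParam (T.toMvPolynomial j) with hq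
  have hqdeg : ∀ j, (q j).IsHomogeneous 2 := fun j => by
    have := (T.toMvPolynomial_isHomogeneous j).aeval (n := 2)
      (quadParam : Fin 3 → MvPolynomial (Fin 2) K) isHomogeneous_quadParam
    rwa [mul_one] at this
  have hl : ∀ p : MvPolynomial (Fin 3) K,
      aeval q (aeval S.toMvPolynomial p) = aeval quadParam p := by
    intro p
    rw [comp_aeval_apply]
    congr 2
    ext1 k
    have h := Matrix.toMvPolynomial_mul S T k
    rw [Matrix.mul_nonsing_inv _ hSu, Matrix.toMvPolynomial_one] at h
    have h2 := congrArg (aeval (quadParam : Fin 3 → MvPolynomial (Fin 2) K)) h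
    rw [aeval_X, aeval_bind₁] at h2
    exact h2.symm
  have hinv : ∀ p : MvPolynomial (Fin 3) K,
      aeval S.toMvPolynomial (aeval T.toMvPolynomial p) = p := by
    intro p
    rw [comp_aeval_apply]
    have : (fun i => aeval S.toMvPolynomial (T.toMvPolynomial i)) = X := by
      rw [← Matrix.toMvPolynomial_one, ← Matrix.nonsing_inv_mul _ hSu]
      ext1 k
      exact (Matrix.toMvPolynomial_mul T S k).symm
    rw [this]
    simp
  have hFq : aeval q (F : MvPolynomial (Fin 3) K) = 0 := by
    have h : (F : MvPolynomial (Fin 3) K) =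
        aeval S.toMvPolynomial (C a * (X 0 * X 1 - X 2 ^ 2)) := by
      rw [hFS]; simp
    rw [h, hl]
    simp [quadParam]
    right; ring
  let ψ : CoordRing F →ₐ[K] MvPolynomial (Fin 2) K :=
    Ideal.Quotient.liftₐ _ (aeval q) (by
      intro x hx
      obtain ⟨b, rfl⟩ := Ideal.mem_span_singleton.mp hx
      rw [map_mul, hFq, zero_mul])
  have hψmk : ∀ p, ψ (Ideal.Quotient.mkₐ K _ p) = aeval q p := fun p => rfl
  have hψ : ∀ i, ∀ x ∈ coordGrading F i,
      ψ.toRingHom x ∈ homogeneousSubmodule (Fin 2) K (2 * i) := by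
    rintro i _ ⟨p, hp, rfl⟩
    exact IsHomogeneous.aeval hp q hqdeg
  have hinj : ∀ i, ∀ x ∈ coordGrading F i, ψ.toRingHom x = 0 → x = 0 := by
    rintro i _ ⟨p, hp, rfl⟩ h0
    replace h0 : aeval q p = 0 := h0
    rw [← hinv p, hl] at h0
    obtain ⟨r, hr⟩ := dvd_of_aeval_quadParam_eq_zero h0
    refine Ideal.Quotient.eq_zero_iff_mem.mpr (Ideal.mem_span_singleton.mpr
      ⟨C a⁻¹ * aeval S.toMvPolynomial r, ?_⟩)
    rw [← hinv p, hr, hFS, map_mul]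
    have hC : (C a * C a⁻¹ : MvPolynomial (Fin 3) K) = 1 := by
      rw [← C_mul, mul_inv_cancel₀ ha, C_1]
    simp only [map_sub, map_mul, map_pow, aeval_X]
    linear_combination -((S.toMvPolynomial 0 * S.toMvPolynomial 1 - S.toMvPolynomial 2 ^ 2) *
      aeval S.toMvPolynomial r) * hC
  have hsurj : ∀ i, ∀ b ∈ homogeneousSubmodule (Fin 2) K (2 * i),
      ∃ x ∈ coordGrading F i, ψ.toRingHom x = b := by
    intro i b hb
    obtain ⟨p, hp, rfl⟩ := exists_aeval_quadParam_eq hb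
    refine ⟨Ideal.Quotient.mkₐ K _ (aeval S.toMvPolynomial p), ⟨_, ?_, rfl⟩, hl p⟩
    have := hp.aeval (n := 1) S.toMvPolynomial (Matrix.toMvPolynomial_isHomogeneous S)
    rwa [one_mul] at this
  have hψX : ∀ j, ψ.toRingHom (coordX F j) = q j := fun j => aeval_X q j
  -- If all `q j` vanish at a point, then so do `s²` and `t²`, which is impossible.
  have hcov' : ⨆ j, Proj.basicOpen (homogeneousSubmodule (Fin 2) K)
      (ψ.toRingHom (coordX F j)) = ⊤ := by
    refine top_le_iff.mp fun x _ => Opens.mem_iSup.mpr ?_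
    by_contra! H
    simp only [Proj.mem_basicOpen, not_not, hψX] at H
    have he : ∀ k, quadParam k ∈ x.asHomogeneousIdeal.toIdeal := by
      intro k
      have h := hl (X k)
      rw [aeval_X, aeval_X, toMvPolynomial_eq_sum, map_sum] at h
      rw [← h]
      refine Ideal.sum_mem _ fun j _ => ?_
      rw [map_mul, aeval_X]
      exact Ideal.mul_mem_left _ _ (H j)
    refine x.not_irrelevant_le (irrelevant_le_span_X.trans ?_)
    rw [Ideal.span_le, Set.range_subset_iff]
    intro k
    have hprime : x.asHomogeneousIdeal.toIdeal.IsPrime := x.isPrime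
    fin_cases k
    · exact hprime.mem_of_pow_mem 2 (he 0)
    · exact hprime.mem_of_pow_mem 2 (he 1)
  obtain ⟨φ, hφ⟩ := exists_veronese_iso hψ two_pos hinj hsurj (coordX_mem F) (fun _ => one_pos)
    (iSup_basicOpen_coordX F) hcov'
  -- The isomorphism respects the structure morphisms to `Spec K`, as can be checked on charts.
  have hbase : ∀ j, (veroneseAway hψ (coordX F j)).comp (baseToAway (coordGrading F) (coordX F j)) =
      baseToAway (homogeneousSubmodule (Fin 2) K) (ψ.toRingHom (coordX F j)) := by
    intro j
    ext1 c
    apply HomogeneousLocalization.val_injective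
    change Localization.mk _ _ = Localization.mk _ _
    congr 1
    · exact ψ.commutes c
    · exact Subtype.ext (map_one ψ)
  have hover : φ.hom ≫ projToSpec (coordGrading F) =
      projToSpec (homogeneousSubmodule (Fin 2) K) := by
    have key : ∀ j : Fin 3, Proj.awayι (homogeneousSubmodule (Fin 2) K) _ (hψ _ _ (coordX_mem F j))
        (Nat.mul_pos two_pos one_pos) ≫ φ.hom ≫ projToSpec (coordGrading F) =
        Proj.awayι (homogeneousSubmodule (Fin 2) K) _ (hψ _ _ (coordX_mem F j))
        (Nat.mul_pos two_pos one_pos) ≫ projToSpec (homogeneousSubmodule (Fin 2) K) := by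
      intro j
      rw [reassoc_of% (hφ j), awayι_projToSpec, awayι_projToSpec, ← Spec.map_comp,
        ← CommRingCat.ofHom_comp, hbase]
    exact (projCover (homogeneousSubmodule (Fin 2) K) _ (fun j => hψ _ _ (coordX_mem F j))
      (fun _ => Nat.mul_pos two_pos one_pos) hcov').openCover.hom_ext _ _ key
  exact ⟨φ.symm, by
    change φ.inv ≫ projToSpec (homogeneousSubmodule (Fin 2) K) = projToSpec (coordGrading F)
    rw [← hover, Iso.inv_hom_id_assoc]⟩

end Parametrization

/-! ### The standard chart of the projective line -/

section ProjectiveLineChart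

attribute [local instance] MvPolynomial.gradedAlgebra

variable (K : Type u) [Field K]

/-- The coordinate ring `K[X₀ / X₁]` of the chart `D₊(X₁)` of the projective line. -/
abbrev LineChartRing : Type u :=
  HomogeneousLocalization.Away (homogeneousSubmodule (Fin 2) K) (X 1 : MvPolynomial (Fin 2) K)

theorem X_mem_homogeneousSubmodule_one (i : Fin 2) :
    (X i : MvPolynomial (Fin 2) K) ∈ homogeneousSubmodule (Fin 2) K 1 := isHomogeneous_X K i

/-- The chart `D₊(X₁)` of the projective line. -/
def ProjectiveLine.chart : Spec (.of (LineChartRing K)) ⟶ ProjectiveLine K :=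
  Proj.awayι (homogeneousSubmodule (Fin 2) K) (X 1) (X_mem_homogeneousSubmodule_one K 1) one_pos

instance : IsOpenImmersion (ProjectiveLine.chart K) :=
  inferInstanceAs (IsOpenImmersion (Proj.awayι (homogeneousSubmodule (Fin 2) K) (X 1)
    (X_mem_homogeneousSubmodule_one K 1) one_pos))

/-- The structure map of `K[X₀ / X₁]`. -/
abbrev LineChartRing.base : K →+* LineChartRing K :=
  baseToAway (homogeneousSubmodule (Fin 2) K) (X 1)

theorem ProjectiveLine.chart_toSpec : ProjectiveLine.chart K ≫ ProjectiveLine.toSpec K =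
    Spec.map (CommRingCat.ofHom (LineChartRing.base K)) :=
  awayι_projToSpec _ _ _

instance : IsDomain (LineChartRing K) := by
  have : IsDomain (Localization.Away (X 1 : MvPolynomial (Fin 2) K)) :=
    IsLocalization.isDomain_localization
      (powers_le_nonZeroDivisors_of_noZeroDivisors (X_ne_zero 1))
  exact (HomogeneousLocalization.val_injective _).isDomain
    (algebraMap (LineChartRing K) (Localization.Away (X 1 : MvPolynomial (Fin 2) K)))

/-- The coordinate `X₀ / X₁`. -/
def LineChartRing.coord : LineChartRing K :=
  HomogeneousLocalization.Away.mk (homogeneousSubmodule (Fin 2) K)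
    (X_mem_homogeneousSubmodule_one K 1) 1 (X 0)
    (by rw [one_smul]; exact X_mem_homogeneousSubmodule_one K 0)

theorem isUnit_eval_X_one : IsUnit ((eval ![0, 1] : MvPolynomial (Fin 2) K →+* K) (X 1)) := by
  simp

/-- Evaluation at the point `(0 : 1)`. -/
def LineChartRing.eval : LineChartRing K →+* K :=
  awayEval (MvPolynomial.eval ![0, 1]) (isUnit_eval_X_one K)

theorem LineChartRing.eval_base (c : K) : LineChartRing.eval K (LineChartRing.base K c) = c :=
  (awayEval_baseToAway _ (isUnit_eval_X_one K) c).trans (eval_C c)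

theorem LineChartRing.coord_ne_zero : LineChartRing.coord K ≠ 0 := by
  intro h
  replace h := congrArg HomogeneousLocalization.val h
  rw [coord, HomogeneousLocalization.Away.val_mk, HomogeneousLocalization.val_zero,
    Localization.mk_eq_mk', IsLocalization.mk'_eq_zero_iff] at h
  obtain ⟨⟨_, k, rfl⟩, hk⟩ := h
  exact mul_ne_zero (pow_ne_zero k (X_ne_zero 1)) (X_ne_zero 0) hk

/-- A form in two variables that vanishes at `(0 : 1)` has no term in `X₁ ^ n`, so `X₀`
divides it. -/
theorem exists_eq_X_mul_of_eval_eq_zero {n : ℕ} {a : MvPolynomial (Fin 2) K}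
    (ha : a.IsHomogeneous n) (h : MvPolynomial.eval ![0, 1] a = 0) : ∃ b, a = X 0 * b := by
  have h1 : aeval (![0, X 1] : Fin 2 → MvPolynomial (Fin 2) K) a = 0 := by
    have h2 := aeval_mul_of_isHomogeneous ha (X 1 : MvPolynomial (Fin 2) K)
      (fun i => C ((![0, 1] : Fin 2 → K) i))
    have h3 : (fun i => X 1 * C ((![0, 1] : Fin 2 → K) i)) =
        (![0, X 1] : Fin 2 → MvPolynomial (Fin 2) K) := by
      funext i
      fin_cases i <;> simp
    have h4 : aeval (fun i => C ((![0, 1] : Fin 2 → K) i)) a =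
        (C (MvPolynomial.eval ![0, 1] a) : MvPolynomial (Fin 2) K) := by
      rw [← MvPolynomial.coe_aeval_eq_eval, ← MvPolynomial.algebraMap_eq]
      exact (MvPolynomial.aeval_algebraMap_apply _ _ a)
    rwa [h3, h4, h, C_0, mul_zero] at h2
  have h5 : a - aeval (![0, X 1] : Fin 2 → MvPolynomial (Fin 2) K) a ∈
      Ideal.span {(X 0 : MvPolynomial (Fin 2) K)} := by
    rw [← Ideal.Quotient.eq]
    have h6 : (Ideal.Quotient.mkₐ K (Ideal.span {(X 0 : MvPolynomial (Fin 2) K)})).comp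
        (aeval (![0, X 1] : Fin 2 → MvPolynomial (Fin 2) K)) = Ideal.Quotient.mkₐ K _ := by
      apply MvPolynomial.algHom_ext
      intro i
      fin_cases i
      · simp only [AlgHom.comp_apply, aeval_X, Fin.zero_eta, Matrix.cons_val_zero, map_zero]
        exact (Ideal.Quotient.eq_zero_iff_mem.mpr (Ideal.mem_span_singleton_self _)).symm
      · simp
    exact (congrArg (fun φ => φ a) h6).symm
  rw [h1, sub_zero, Ideal.mem_span_singleton] at h5
  exact h5

/-- The ideal of the point `(0 : 1)` in its chart is generated by the coordinate. -/
theorem LineChartRing.ker_eval : RingHom.ker (LineChartRing.eval K) =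
    Ideal.span {LineChartRing.coord K} := by
  apply le_antisymm
  · intro x hx
    obtain ⟨n, a, ha, rfl⟩ :=
      HomogeneousLocalization.Away.mk_surjective _ (X_mem_homogeneousSubmodule_one K 1) x
    have h1 := awayEval_mk_mul (𝒜 := homogeneousSubmodule (Fin 2) K)
      (MvPolynomial.eval ![(0 : K), 1]) (isUnit_eval_X_one K)
      (X_mem_homogeneousSubmodule_one K 1) n a ha
    have hx' : awayEval (MvPolynomial.eval ![(0 : K), 1]) (isUnit_eval_X_one K)
      (HomogeneousLocalization.Away.mk (homogeneousSubmodule (Fin 2) K)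
        (X_mem_homogeneousSubmodule_one K 1) n a ha)
        = 0 := hx
    rw [hx', zero_mul] at h1
    have ha' : a.IsHomogeneous n := by rwa [smul_eq_mul, mul_one] at ha
    obtain ⟨b, rfl⟩ := exists_eq_X_mul_of_eval_eq_zero K ha' h1.symm
    have hdeg (d : Fin 2 →₀ ℕ) : Finsupp.weight (1 : Fin 2 → ℕ) d = d.degree :=
      (DFunLike.congr_fun (Finsupp.degree_eq_weight_one (R := ℕ)) d).symm
    have hb : ∀ d, coeff d b ≠ 0 → d.degree + 1 = n := by
      intro d hd
      have h2 := ha' (d := Finsupp.single 0 1 + d) (by rwa [coeff_X_mul])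
      rw [hdeg] at h2
      simpa [add_comm] using h2
    rcases eq_or_ne b 0 with rfl | hb0
    · convert Ideal.zero_mem _
      apply HomogeneousLocalization.val_injective
      rw [HomogeneousLocalization.Away.val_mk, HomogeneousLocalization.val_zero, mul_zero,
        Localization.mk_zero]
    obtain ⟨d₀, hd₀⟩ := MvPolynomial.ne_zero_iff.mp hb0
    obtain ⟨k, rfl⟩ : ∃ k, n = k + 1 := ⟨_, (hb d₀ hd₀).symm⟩
    have hbk : b ∈ homogeneousSubmodule (Fin 2) K (k • 1) := by
      rw [smul_eq_mul, mul_one]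
      intro d hd
      rw [hdeg]
      exact Nat.add_right_cancel (hb d hd)
    refine Ideal.mem_span_singleton.mpr ⟨HomogeneousLocalization.Away.mk
      (homogeneousSubmodule (Fin 2) K) (X_mem_homogeneousSubmodule_one K 1) k b hbk, ?_⟩
    apply HomogeneousLocalization.val_injective
    rw [HomogeneousLocalization.val_mul, coord, HomogeneousLocalization.Away.val_mk,
      HomogeneousLocalization.Away.val_mk, HomogeneousLocalization.Away.val_mk,
      Localization.mk_mul]
    congr 1
    exact Subtype.ext (by simp [pow_succ, mul_comm])
  · rw [Ideal.span_singleton_le_iff_mem, RingHom.mem_ker]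
    have h1 := awayEval_mk_mul (𝒜 := homogeneousSubmodule (Fin 2) K)
      (MvPolynomial.eval ![(0 : K), 1]) (isUnit_eval_X_one K)
      (X_mem_homogeneousSubmodule_one K 1) 1 (X 0)
      (by rw [one_smul]; exact X_mem_homogeneousSubmodule_one K 0)
    rw [eval_X, eval_X] at h1
    rw [show (![(0 : K), 1] : Fin 2 → K) 1 = 1 from rfl, one_pow, mul_one] at h1
    exact h1

end ProjectiveLineChart

/-! ### The ideal sheaf of a point as a sheaf of modules -/

section PointIdeal

variable {X : Scheme.{u}} (x : X)

/-- The regular functions on `U` that vanish at the point `x`; all of them when `x ∉ U`. -/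
def pointIdeal (U : X.Opens) : Ideal Γ(X, U) where
  carrier := {s | x ∉ X.basicOpen s}
  zero_mem' := by simp
  add_mem' {a b} ha hb h := (X.basicOpen_add_le a b h).elim ha hb
  smul_mem' c a ha h := ha ((X.basicOpen_mul c a).le h).2

theorem mem_pointIdeal {U : X.Opens} {s : Γ(X, U)} : s ∈ pointIdeal x U ↔ x ∉ X.basicOpen s :=
  Iff.rfl

theorem map_mem_pointIdeal_iff {U V : X.Opens} (i : V ⟶ U) (hx : x ∈ U → x ∈ V) {s : Γ(X, U)} :
    X.presheaf.map i.op s ∈ pointIdeal x V ↔ s ∈ pointIdeal x U := by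
  rw [mem_pointIdeal, mem_pointIdeal, Scheme.basicOpen_res, not_iff_not]
  exact ⟨fun h => h.2, fun h => ⟨hx (X.basicOpen_le s h), h⟩⟩

theorem map_mem_pointIdeal {U V : X.Opens} (i : V ⟶ U) {s : Γ(X, U)} (hs : s ∈ pointIdeal x U) :
    X.presheaf.map i.op s ∈ pointIdeal x V := by
  rw [mem_pointIdeal, Scheme.basicOpen_res]
  exact fun h => hs h.2

theorem resFun_mem_pointIdeal {U V : X.Opens} (h : V ≤ U) {s : Γ(X, U)} (hs : s ∈ pointIdeal x U) :
    resFun h s ∈ pointIdeal x V := map_mem_pointIdeal x (homOfLE h) hs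

/-- The presheaf of regular functions that vanish at `x`. -/
def pointPresheaf : X.Opensᵒᵖ ⥤ Ab.{u} where
  obj U := AddCommGrpCat.of (pointIdeal x U.unop)
  map {U V} i := AddCommGrpCat.ofHom (AddMonoidHom.mk'
    (fun s : pointIdeal x U.unop =>
      (⟨X.presheaf.map i s.1, map_mem_pointIdeal x i.unop s.2⟩ : pointIdeal x V.unop))
    (fun s t => Subtype.ext (map_add _ _ _)))
  map_id U := by
    ext s
    change X.presheaf.map (𝟙 U) s.1 = s.1
    rw [X.presheaf.map_id]
    rfl
  map_comp {U V W} i j := by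
    ext s
    change X.presheaf.map (i ≫ j) s.1 = X.presheaf.map j (X.presheaf.map i s.1)
    rw [X.presheaf.map_comp]
    rfl

instance (U : X.Opensᵒᵖ) : Module (X.ringCatSheaf.obj.obj U) ((pointPresheaf x).obj U) :=
  inferInstanceAs (Module Γ(X, U.unop) (pointIdeal x U.unop))

theorem isSheaf_pointPresheaf : TopCat.Presheaf.IsSheaf (X := X) (pointPresheaf x) := by
  rw [TopCat.Presheaf.isSheaf_iff_isSheaf_comp (forget Ab.{u})]
  apply TopCat.Presheaf.isSheaf_of_isSheafUniqueGluing_types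
  intro ι U sf hsf
  have hsf' : TopCat.Presheaf.IsCompatible X.presheaf U (fun i => (sf i).1) := by
    intro i j
    exact congrArg Subtype.val (hsf i j)
  obtain ⟨s, hs, huniq⟩ := X.sheaf.existsUnique_gluing U _ hsf'
  have hs' : s ∈ pointIdeal x (iSup U) := by
    intro hx
    obtain ⟨i, hi⟩ := Opens.mem_iSup.mp (X.basicOpen_le s hx)
    have hi' : X.presheaf.map (Opens.leSupr U i).op s ∈ pointIdeal x (U i) :=
      (congrArg (· ∈ pointIdeal x (U i)) (hs i)).mpr (sf i).2
    exact (map_mem_pointIdeal_iff x (Opens.leSupr U i) (fun _ => hi)).mp hi' hx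
  refine ⟨⟨s, hs'⟩, fun i => Subtype.ext (hs i), ?_⟩
  rintro ⟨t, ht⟩ hts
  exact Subtype.ext (huniq t (fun i => congrArg Subtype.val (hts i)))

/-- The ideal sheaf of the point `x`, as a sheaf of modules. -/
def pointModule : X.Modules where
  val := PresheafOfModules.ofPresheaf (pointPresheaf x) (fun _ _ i r m =>
    Subtype.ext (map_mul (X.presheaf.map i).hom r m.1))
  isSheaf := isSheaf_pointPresheaf x

/-- A section of the ideal sheaf of `x` given by a function that vanishes at `x`. -/
def pointSection {U : X.Opens} (s : Γ(X, U)) (hs : s ∈ pointIdeal x U) : Γ(pointModule x, U) :=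
  (⟨s, hs⟩ : pointIdeal x U)

theorem pointSection_inj {U : X.Opens} {s t : Γ(X, U)} {hs : s ∈ pointIdeal x U}
    {ht : t ∈ pointIdeal x U} : pointSection x s hs = pointSection x t ht ↔ s = t :=
  Subtype.ext_iff

theorem exists_pointSection {U : X.Opens} (m : Γ(pointModule x, U)) :
    ∃ s hs, m = pointSection x s hs := ⟨m.1, m.2, rfl⟩

/-- The frame condition for a section of the ideal sheaf, in terms of regular functions: the
function is cancellable and divides all functions that vanish at `x`. -/
theorem isFrame_pointSection_iff {U : X.Opens} (t : Γ(X, U)) (ht : t ∈ pointIdeal x U) :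
    IsFrame (pointModule x) U (pointSection x t ht) ↔ ∀ (V : X.Opens) (h : V ≤ U),
      (∀ r : Γ(X, V), r * resFun h t = 0 → r = 0) ∧
      ∀ s ∈ pointIdeal x V, ∃ r : Γ(X, V), r * resFun h t = s := by
  refine forall₂_congr fun V h => and_congr ?_ ?_
  · constructor
    · intro hi r hr
      refine hi ((pointSection_inj x (ht := Ideal.mul_mem_left _ 0
        (resFun_mem_pointIdeal x h ht))).mpr ?_)
      exact hr.trans (zero_mul _).symm
    · intro hi r r' hr
      have hr' : r * resFun h t = r' * resFun h t := (pointSection_inj x).mp hr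
      rw [← sub_eq_zero]
      apply hi
      rw [sub_mul, hr', sub_self]
  · constructor
    · intro hi s hs
      obtain ⟨r, hr⟩ := hi (pointSection x s hs)
      exact ⟨r, (pointSection_inj x).mp hr⟩
    · intro hi m
      obtain ⟨s, hs, rfl⟩ := exists_pointSection x m
      obtain ⟨r, hr⟩ := hi s hs
      exact ⟨r, (pointSection_inj x).mpr hr⟩

end PointIdeal

/-! ### The line bundle of a rational point -/

section PointFrame

variable {X : Scheme.{u}} (x : X)

/-- A section of the ideal sheaf of `x` is a frame if its germ is a non-zero-divisor everywhere,
is invertible away from `x`, and generates the maximal ideal at `x`. -/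
theorem isFrame_pointSection {U : X.Opens} (t : Γ(X, U)) (ht : t ∈ pointIdeal x U)
    (h0 : ∀ y (hy : y ∈ U), X.presheaf.germ U y hy t ∈ nonZeroDivisors (X.presheaf.stalk y))
    (hdvd : ∀ y (hy : y ∈ U) (s : X.presheaf.stalk y), (y = x → ¬ IsUnit s) →
      X.presheaf.germ U y hy t ∣ s) :
    IsFrame (pointModule x) U (pointSection x t ht) := by
  rw [isFrame_pointSection_iff]
  have hinj : ∀ (V : X.Opens) (h : V ≤ U) (r : Γ(X, V)), r * resFun h t = 0 → r = 0 := by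
    intro V h r hr
    refine TopCat.Presheaf.section_ext X.sheaf V r 0 fun y hy => ?_
    have h1 := congrArg (X.presheaf.germ V y hy) hr
    rw [map_mul, map_zero] at h1
    have h2 : X.presheaf.germ V y hy (resFun h t) = X.presheaf.germ U y (h hy) t :=
      TopCat.Presheaf.germ_res_apply X.presheaf (homOfLE h) y hy t
    rw [h2] at h1
    refine Eq.trans ?_ (map_zero (X.presheaf.germ V y hy).hom).symm
    exact (mul_right_mem_nonZeroDivisors_eq_zero_iff (h0 y (h hy))).mp h1
  refine fun V h => ⟨hinj V h, fun s hs => ?_⟩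
  -- Locally on `V` the quotient of `s` by `t` exists, and it is unique, so the quotients glue.
  have hloc : ∀ y : V, ∃ (W : X.Opens) (hW : W ≤ V) (_ : y.1 ∈ W) (r : Γ(X, W)),
      r * resFun (hW.trans h) t = resFun hW s := by
    rintro ⟨y, hy⟩
    obtain ⟨c, hc⟩ := hdvd y (h hy) (X.presheaf.germ V y hy s) (by
      rintro rfl hu
      exact hs ((X.mem_basicOpen s _ hy).mpr hu))
    obtain ⟨W₁, hW₁, hy₁, r, rfl⟩ := X.presheaf.exists_le_germ_eq c hy
    obtain ⟨W, hyW, i, i', hi⟩ := X.presheaf.germ_eq y hy₁ hy (r * resFun (hW₁.trans h) t) s (by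
      rw [hc, map_mul, mul_comm]
      congr 1
      exact TopCat.Presheaf.germ_res_apply X.presheaf (homOfLE (hW₁.trans h)) y hy₁ t)
    refine ⟨W, leOfHom i', hyW, X.presheaf.map i.op r, ?_⟩
    rw [map_mul] at hi
    refine Eq.trans ?_ hi
    congr 1
    simp only [resFun]
    rw [← CommRingCat.comp_apply, ← Functor.map_comp]
    rfl
  choose W hW hyW r hr using hloc
  have hcov : iSup W = V := le_antisymm (iSup_le hW) fun y hy => Opens.mem_iSup.mpr ⟨⟨y, hy⟩, hyW _⟩
  have hres : ∀ {A B D : X.Opens} (h1 : A ≤ B) (h2 : B ≤ D) (f : Γ(X, D)),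
      resFun h1 (resFun h2 f) = resFun (h1.trans h2) f := by
    intro A B D h1 h2 f
    simp only [resFun]
    rw [← CommRingCat.comp_apply, ← Functor.map_comp]
    rfl
  have hmul : ∀ {A B : X.Opens} (h1 : A ≤ B) (f g : Γ(X, B)),
      resFun h1 (f * g) = resFun h1 f * resFun h1 g := fun h1 f g => map_mul _ f g
  obtain ⟨q, hq⟩ : ∃ q : Γ(X, V), ∀ y, resFun (hW y) q = r y :=
    (X.sheaf.existsUnique_gluing' W V (fun y => homOfLE (hW y)) hcov.ge r (by
    intro y z
    change resFun inf_le_left (r y) = resFun inf_le_right (r z)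
    rw [← sub_eq_zero]
    apply hinj _ ((inf_le_left.trans (hW y)).trans h)
    have h1 := congrArg (resFun (inf_le_left : W y ⊓ W z ≤ W y)) (hr y)
    have h2 := congrArg (resFun (inf_le_right : W y ⊓ W z ≤ W z)) (hr z)
    rw [hmul, hres, hres] at h1 h2
    rw [sub_mul, h1, h2, sub_self])).exists
  refine ⟨q, ?_⟩
  refine X.sheaf.eq_of_locally_eq' W V (fun y => homOfLE (hW y)) hcov.ge
    (q * resFun h t) s fun y => ?_
  change resFun (hW y) (q * resFun h t) = resFun (hW y) s
  rw [hmul, hres, ← hr y, hq]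

/-- A generator of the maximal ideal of a local ring has order `1`. -/
theorem ord_eq_one_of_dvd {A : Type*} [CommRing A] [IsLocalRing A] {a : A} (ha : ¬ IsUnit a)
    (h : ∀ s : A, ¬ IsUnit s → a ∣ s) : Ring.ord A a = 1 := by
  rw [Ring.ord, Module.length_eq_one_iff, isSimpleModule_iff_isCoatom, ← Ideal.isMaximal_def]
  have h1 : Ideal.span {a} = IsLocalRing.maximalIdeal A :=
    le_antisymm ((Ideal.span_singleton_le_iff_mem _).mpr ha)
      fun s hs => Ideal.mem_span_singleton.mpr (h s hs)
  rw [h1]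
  infer_instance

/-- A section of `f` over `Spec K` passes through a point of degree one. -/
theorem residueDegree_eq_one {K : Type u} [Field K] (f : X ⟶ Spec (.of K)) (g : Spec (.of K) ⟶ X)
    (hg : g ≫ f = 𝟙 _) (p : Spec (.of K)) : f.residueDegree (g p) = 1 := by
  have h1 := Scheme.residueFieldMap_comp g f p
  have : IsOpenImmersion (g ≫ f) := by rw [hg]; infer_instance
  have h2 : Function.Bijective ((g ≫ f).residueFieldMap p).hom :=
    ConcreteCategory.bijective_of_isIso ((g ≫ f).residueFieldMap p)
  rw [h1] at h2
  replace h2 : Function.Bijective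
    ((g.residueFieldMap p).hom ∘ (f.residueFieldMap (g p)).hom) := h2
  have h3 : Function.Bijective (f.residueFieldMap (g p)).hom := by
    refine ⟨(f.residueFieldMap (g p)).hom.injective, fun y => ?_⟩
    obtain ⟨z, hz⟩ := h2.2 ((g.residueFieldMap p).hom y)
    exact ⟨z, (g.residueFieldMap p).hom.injective hz⟩
  let := (f.residueFieldMap (g p)).hom.toAlgebra
  change Module.finrank _ _ = 1
  rw [← Module.finrank_self ((Spec (.of K)).residueField (f (g p)))]
  exact ((AlgEquiv.ofBijective (Algebra.ofId _ _) h3).toLinearEquiv.finrank_eq).symm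

end PointFrame

section PointDegree

/-- An element of `R` as a function on the image of an open immersion `Spec R ⟶ X`. -/
def chartFun {X : Scheme.{u}} {R : CommRingCat.{u}} (j : Spec R ⟶ X) [IsOpenImmersion j] (t : R) :
    Γ(X, j ''ᵁ ⊤) :=
  (j.appIso ⊤).inv ((Scheme.ΓSpecIso R).inv t)

section ChartFun

variable {X : Scheme.{u}} {R : CommRingCat.{u}} (j : Spec R ⟶ X) [IsOpenImmersion j]

theorem apply_mem_image_top (p : Spec R) : j p ∈ j ''ᵁ ⊤ := ⟨p, trivial, rfl⟩

/-- The germ of the function on `X` given by an element of `R`. -/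
def chartGerm (p : Spec R) (t : R) : X.presheaf.stalk (j p) :=
  X.presheaf.germ (j ''ᵁ ⊤) (j p) (apply_mem_image_top j p) (chartFun j t)

theorem exists_stalk_equiv_stalk (p : Spec R) :
    ∃ e : X.presheaf.stalk (j p) ≃+* (Spec R).presheaf.stalk p, ∀ t : R,
      e (chartGerm j p t) = (Spec R).presheaf.germ ⊤ p trivial ((Scheme.ΓSpecIso R).inv t) := by
  refine ⟨(asIso (j.stalkMap p)).commRingCatIsoToRingEquiv, fun t => ?_⟩
  have h : (j.appIso ⊤).inv ≫ X.presheaf.germ (j ''ᵁ ⊤) (j p) (apply_mem_image_top j p) ≫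
      j.stalkMap p = (Spec R).presheaf.germ ⊤ p trivial := by
    rw [Scheme.Hom.germ_stalkMap, Scheme.Hom.appIso_inv_app_assoc]
    exact TopCat.Presheaf.germ_res _ _ p _
  exact congrArg (fun φ => φ.hom ((Scheme.ΓSpecIso R).inv t)) h

/-- The local ring at a point of an affine chart is the localization of the ring of the chart. -/
theorem exists_stalk_equiv (p : PrimeSpectrum R) :
    ∃ e : X.presheaf.stalk (j p) ≃+* Localization.AtPrime p.asIdeal, ∀ t : R,
      e (chartGerm j p t) = algebraMap R _ t := by
  obtain ⟨e, he⟩ := exists_stalk_equiv_stalk j p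
  refine ⟨e.trans (Spec.stalkIso R p).commRingCatIsoToRingEquiv, fun t => ?_⟩
  refine (congrArg (Spec.stalkIso R p).hom (he t)).trans ?_
  have h : (Scheme.ΓSpecIso R).inv ≫ (Spec R).presheaf.germ ⊤ p trivial ≫
      (Spec.stalkIso R p).hom = CommRingCat.ofHom (algebraMap R _) := by
    rw [Spec.germ_stalkMapIso_hom, Iso.inv_hom_id_assoc]
  exact congrArg (fun φ => φ.hom t) h

theorem isUnit_chartGerm_iff (p : PrimeSpectrum R) {t : R} :
    IsUnit (chartGerm j p t) ↔ t ∉ p.asIdeal := by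
  obtain ⟨e, he⟩ := exists_stalk_equiv j p
  rw [← MulEquiv.isUnit_map e, he]
  exact IsLocalization.AtPrime.isUnit_to_map_iff _ p.asIdeal t

theorem chartGerm_mem_nonZeroDivisors [IsDomain R] (p : PrimeSpectrum R) {t : R} (ht : t ≠ 0) :
    chartGerm j p t ∈ nonZeroDivisors (X.presheaf.stalk (j p)) := by
  obtain ⟨e, he⟩ := exists_stalk_equiv j p
  rw [← MulEquivClass.map_nonZeroDivisors e.symm, ← e.symm_apply_apply (chartGerm j p t), he]
  refine Submonoid.mem_map_of_mem _ ?_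
  have : IsDomain (Localization.AtPrime p.asIdeal) :=
    IsLocalization.isDomain_localization p.asIdeal.primeCompl_le_nonZeroDivisors
  refine mem_nonZeroDivisors_of_ne_zero ?_
  rwa [Ne, FaithfulSMul.algebraMap_eq_zero_iff]

/-- A generator of a prime ideal generates the maximal ideal of the local ring. -/
theorem chartGerm_dvd (p : PrimeSpectrum R) {t : R} (hp : p.asIdeal = Ideal.span {t})
    {s : X.presheaf.stalk (j p)} (hs : ¬ IsUnit s) : chartGerm j p t ∣ s := by
  obtain ⟨e, he⟩ := exists_stalk_equiv j p
  rw [← MulEquiv.isUnit_map e] at hs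
  rw [← map_dvd_iff e, he]
  obtain ⟨⟨r, v⟩, hrv⟩ := IsLocalization.surj p.asIdeal.primeCompl (e s)
  have hr : r ∈ p.asIdeal := by
    by_contra hr
    have h1 := (IsLocalization.AtPrime.isUnit_to_map_iff
      (Localization.AtPrime p.asIdeal) p.asIdeal r).mpr hr
    rw [← hrv] at h1
    exact hs (isUnit_of_mul_isUnit_left h1)
  rw [hp, Ideal.mem_span_singleton] at hr
  have h2 := map_dvd (algebraMap R (Localization.AtPrime p.asIdeal)) hr
  rw [← hrv] at h2
  exact (IsLocalization.map_units _ v).dvd_mul_right.mp h2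

end ChartFun

/-- A rational point lying in an affine chart in which its ideal is generated by one element
`t ≠ 0` is an effective Cartier divisor of degree one, so its ideal sheaf is a line bundle of
degree `-1`. -/
theorem exists_lineBundle_of_chart {K : Type u} [Field K] {X : Scheme.{u}}
    (f : X ⟶ Spec (.of K)) [IsSeparated f] {R : CommRingCat.{u}} [IsDomain R] (j : Spec R ⟶ X)
    [IsOpenImmersion j] (base : K →+* R) (hj : j ≫ f = Spec.map (CommRingCat.ofHom base))
    (ε : R →+* K) (hε : ε.comp base = RingHom.id K) {t : R} (ht : t ≠ 0)
    (hker : RingHom.ker ε = Ideal.span {t}) :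
    ∃ L : X.Modules, IsLineBundle L ∧ HasDegree f L (-1) := by
  set g : Spec (.of K) ⟶ X := Spec.map (CommRingCat.ofHom ε) ≫ j with hgdef
  have hg : g ≫ f = 𝟙 _ := by
    rw [hgdef, Category.assoc, hj, ← Spec.map_comp, ← CommRingCat.ofHom_comp, hε]
    exact Spec.map_id _
  set pt : Spec (.of K) := IsLocalRing.closedPoint K
  set p₀ : PrimeSpectrum R := Spec.map (CommRingCat.ofHom ε) pt with hp₀
  set x : X := j p₀ with hx
  have hgx : g pt = x := rfl
  have hp₀I : p₀.asIdeal = Ideal.span {t} := by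
    rw [← hker]
    change Ideal.comap ε (IsLocalRing.maximalIdeal K) = _
    rw [IsLocalRing.maximalIdeal_eq_bot]
    rfl
  have hmax : (Ideal.span {t}).IsMaximal := by
    rw [← hker]
    exact RingHom.ker_isMaximal_of_surjective ε fun c => ⟨base c, DFunLike.congr_fun hε c⟩
  -- A section of a separated morphism is a closed immersion, so `x` is a closed point.
  have hclosed : IsClosed ({x} : Set X) := by
    have : IsClosedImmersion (g ≫ f) := by rw [hg]; infer_instance
    have : IsClosedImmersion g := IsClosedImmersion.of_comp g f
    have h1 := g.isClosedEmbedding.isClosed_range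
    have h2 : Set.range g = {x} := by
      ext y
      constructor
      · rintro ⟨q, rfl⟩
        rw [Subsingleton.elim q pt]
        rfl
      · rintro rfl
        exact ⟨pt, rfl⟩
    rwa [h2] at h1
  -- The function `1` is a frame on the complement of `x`, and `t` is a frame on the chart.
  set U : X.Opens := ⟨{x}ᶜ, hclosed.isOpen_compl⟩ with hU
  have hxU : x ∉ U := fun h => h rfl
  set V : X.Opens := j ''ᵁ ⊤ with hV
  have hxV : x ∈ V := ⟨p₀, trivial, rfl⟩
  set τ : Γ(X, V) := chartFun j t with hτ
  -- The germ of `t` at the points of the chart.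
  have hτ0 : ∀ y (hy : y ∈ V), X.presheaf.germ V y hy τ ∈ nonZeroDivisors (X.presheaf.stalk y) := by
    rintro _ ⟨p, -, rfl⟩
    exact chartGerm_mem_nonZeroDivisors j p ht
  have hτu : ∀ y (hy : y ∈ V), y ≠ x → IsUnit (X.presheaf.germ V y hy τ) := by
    rintro _ ⟨p, -, rfl⟩ hp
    refine (isUnit_chartGerm_iff j p).mpr fun htp => hp ?_
    have h1 : Ideal.span {t} = PrimeSpectrum.asIdeal p :=
      hmax.eq_of_le (PrimeSpectrum.isPrime p).ne_top ((Ideal.span_singleton_le_iff_mem _).mpr htp)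
    have h2 : p = p₀ := PrimeSpectrum.ext (h1.symm.trans hp₀I.symm)
    exact congrArg j h2
  have hτx : ¬ IsUnit (X.presheaf.germ V x hxV τ) := fun h =>
    (isUnit_chartGerm_iff j p₀).mp h (hp₀I.ge (Ideal.mem_span_singleton_self t))
  have hdvd : ∀ s : X.presheaf.stalk x, ¬ IsUnit s → X.presheaf.germ V x hxV τ ∣ s :=
    fun s hs => chartGerm_dvd j p₀ hp₀I hs
  have hτI : τ ∈ pointIdeal x V := fun h => hτx ((X.mem_basicOpen τ x hxV).mp h)
  have h1I : (1 : Γ(X, U)) ∈ pointIdeal x U := fun h => hxU (X.basicOpen_le _ h)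
  have hfV : IsFrame (pointModule x) V (pointSection x τ hτI) := by
    refine isFrame_pointSection x τ hτI hτ0 fun y hy s hs => ?_
    rcases eq_or_ne y x with rfl | hyx
    · exact hdvd s (hs rfl)
    · exact (hτu y hy hyx).dvd
  have hfU : IsFrame (pointModule x) U (pointSection x 1 h1I) := by
    refine isFrame_pointSection x 1 h1I (fun y hy => ?_) (fun y hy s _ => ?_)
    · rw [map_one]
      exact one_mem _
    · rw [map_one]
      exact one_dvd _
  -- The section `1` has a simple pole at `x` in terms of the frame `t`: `t • 1 = 1 • t`.
  refine ⟨pointModule x, fun y => ?_, U, pointSection x 1 h1I, Finsupp.single x (-1), ?_, ?_, ?_⟩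
  · by_cases hy : y = x
    · exact ⟨V, hy ▸ hxV, _, hfV⟩
    · exact ⟨U, hy, _, hfU⟩
  · -- If `x` were an isolated point, its ideal in the domain `R` would be zero.
    rw [hU]
    change Dense ({x}ᶜ : Set X)
    rw [dense_compl_singleton_iff_not_open]
    intro ho
    have h1 : IsOpen (j ⁻¹' {x}) := ho.preimage j.continuous
    have h2 : (⊥ : PrimeSpectrum R) ∈ j ⁻¹' {x} := by
      have h3 : (⊥ : PrimeSpectrum R) ⤳ p₀ := (PrimeSpectrum.le_iff_specializes _ _).mp bot_le
      exact h3.mem_open h1 rfl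
    have h3 : (⊥ : PrimeSpectrum R) = p₀ := j.isOpenEmbedding.injective h2
    have h4 : (⊥ : Ideal R) = Ideal.span {t} := (congrArg PrimeSpectrum.asIdeal h3).trans hp₀I
    exact ht (Ideal.span_singleton_eq_bot.mp h4.symm)
  · intro y
    by_cases hy : y = x
    · subst hy
      refine ⟨V, hxV, _, 1, τ, hfV, ?_, hτ0 _ hxV, ?_, ?_⟩
      · rw [map_one]
        exact one_mem _
      · refine (pointSection_inj _).mpr ?_
        change resFun (inf_le_right : U ⊓ V ≤ V) τ *
          (X.presheaf.map (homOfLE (inf_le_left : U ⊓ V ≤ U)).op).hom 1 =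
            (X.presheaf.map (homOfLE (inf_le_right : U ⊓ V ≤ V)).op).hom 1 *
              resFun (inf_le_right : U ⊓ V ≤ V) τ
        rw [map_one, map_one, mul_one, one_mul]
      · rw [map_one, ord_eq_one_of_dvd hτx hdvd, Ring.ord_one, Finsupp.single_eq_same]
        rfl
    · refine ⟨U, hy, _, 1, 1, hfU, ?_, ?_, rfl, ?_⟩
      · rw [map_one]
        exact one_mem _
      · rw [map_one]
        exact one_mem _
      · rw [Finsupp.single_eq_of_ne hy, sub_self]
  · rw [Finsupp.sum_single_index (zero_mul _), ← hgx, residueDegree_eq_one f g hg pt]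
    rfl

end PointDegree

/-! ### Rational points and points of odd degree -/

section Implications

attribute [local instance] MvPolynomial.gradedAlgebra

variable {K : Type u} [Field K]

theorem LineChartRing.eval_comp_base :
    (LineChartRing.eval K).comp (LineChartRing.base K) = RingHom.id K :=
  RingHom.ext (LineChartRing.eval_base K)

/-- The rational point `(0 : 1)` of the projective line. -/
theorem ProjectiveLine.exists_section :
    ∃ p : Spec (.of K) ⟶ ProjectiveLine K, p ≫ ProjectiveLine.toSpec K = 𝟙 (Spec (.of K)) := by
  refine ⟨Spec.map (CommRingCat.ofHom (LineChartRing.eval K)) ≫ ProjectiveLine.chart K, ?_⟩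
  rw [Category.assoc, ProjectiveLine.chart_toSpec, ← Spec.map_comp, ← CommRingCat.ofHom_comp,
    LineChartRing.eval_comp_base]
  exact Spec.map_id _

instance projToSpec_isSeparated {A : Type u} [CommRing A] [Algebra K A] (𝒜 : ℕ → Submodule K A)
    [GradedAlgebra 𝒜] : IsSeparated (projToSpec 𝒜) := by
  have := Proj.isSeparated 𝒜
  unfold projToSpec
  infer_instance

variable {n : ℕ} (F : homogeneousSubmodule (Fin 3) K n)

instance : IsSeparated (PlaneCurve.toSpec F) :=
  projToSpec_isSeparated (coordGrading F)

theorem PlaneCurve.exists_lineBundle_of_iso (φ : PlaneCurve F ≅ ProjectiveLine K)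
    (hφ : φ.hom ≫ ProjectiveLine.toSpec K = PlaneCurve.toSpec F) :
    ∃ L : (PlaneCurve F).Modules, IsLineBundle L ∧ HasDegree (PlaneCurve.toSpec F) L (-1) := by
  have : IsDomain (CommRingCat.of (LineChartRing K)) := inferInstanceAs (IsDomain (LineChartRing K))
  refine exists_lineBundle_of_chart (PlaneCurve.toSpec F) (ProjectiveLine.chart K ≫ φ.inv)
    (LineChartRing.base K) ?_ (LineChartRing.eval K) LineChartRing.eval_comp_base
    (LineChartRing.coord_ne_zero K) (LineChartRing.ker_eval K)
  rw [← hφ, Category.assoc, Iso.inv_hom_id_assoc, ProjectiveLine.chart_toSpec]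

/-- The residue field of the point of `Spec K` is `K`. -/
theorem exists_residueField_equiv (y : Spec (.of K)) :
    ∃ ι : K →+* (Spec (.of K)).residueField y, Function.Bijective ι ∧
      (Spec (.of K)).fromSpecResidueField y = Spec.map (CommRingCat.ofHom ι) := by
  change PrimeSpectrum K at y
  have hy : y.asIdeal.IsMaximal := by
    rw [y.asIdeal.eq_bot_of_prime]
    exact Ideal.bot_isMaximal
  have hb : Function.Bijective (algebraMap K y.asIdeal.ResidueField) := by
    refine ⟨(algebraMap K y.asIdeal.ResidueField).injective, ?_⟩
    rw [IsScalarTower.algebraMap_eq K (K ⧸ y.asIdeal) y.asIdeal.ResidueField]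
    exact (Ideal.bijective_algebraMap_quotient_residueField y.asIdeal).2.comp
      Ideal.Quotient.mk_surjective
  refine ⟨(Scheme.Spec.residueFieldIso (.of K) y).inv.hom.comp
      (algebraMap K y.asIdeal.ResidueField),
    (ConcreteCategory.bijective_of_isIso (Scheme.Spec.residueFieldIso (.of K) y).inv).comp hb, ?_⟩
  exact (Scheme.Spec.map_residueFieldIso_inv_eq_fromSpecResidueField (.of K) y).symm.trans
    (Spec.map_comp _ _).symm

/-- A point of odd residue degree on a conic yields a zero of the conic over `K`. -/
theorem PlaneCurve.exists_eval_eq_zero_of_odd_residueDegree (F : homogeneousSubmodule (Fin 3) K 2)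
    (x : PlaneCurve F) (hx : Odd ((PlaneCurve.toSpec F).residueDegree x)) :
    ∃ w : Fin 3 → K, w ≠ 0 ∧ MvPolynomial.eval w (F : MvPolynomial (Fin 3) K) = 0 := by
  set f := PlaneCurve.toSpec F
  obtain ⟨ι, hbij, hι⟩ := exists_residueField_equiv (f x)
  let ρ : K →+* (PlaneCurve F).residueField x := (f.residueFieldMap x).hom.comp ι
  have hρ : (PlaneCurve F).fromSpecResidueField x ≫ f = Spec.map (CommRingCat.ofHom ρ) := by
    rw [← Scheme.Hom.SpecMap_residueFieldMap_fromSpecResidueField, hι, ← Spec.map_comp]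
    rfl
  obtain ⟨v, hv, h0⟩ := PlaneCurve.exists_coordinates F _ ρ hρ
  let := ρ.toAlgebra
  refine springer (K := K) (L := (PlaneCurve F).residueField x) _ F.2 rfl ?_ v hv h0
  convert hx
  let := (f.residueFieldMap x).hom.toAlgebra
  let := ι.toAlgebra
  have : IsScalarTower K ((Spec (.of K)).residueField (f x)) ((PlaneCurve F).residueField x) :=
    IsScalarTower.of_algebraMap_eq fun _ => rfl
  change _ = Module.finrank ((Spec (.of K)).residueField (f x)) ((PlaneCurve F).residueField x)
  rw [← Module.finrank_mul_finrank K ((Spec (.of K)).residueField (f x))]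
  rw [← (AlgEquiv.ofBijective (Algebra.ofId K ((Spec (.of K)).residueField (f x)))
    hbij).toLinearEquiv.finrank_eq, Module.finrank_self, one_mul]

/-- A divisor of odd degree contains a point of odd residue degree. -/
theorem PlaneCurve.exists_eval_eq_zero_of_hasDegree (F : homogeneousSubmodule (Fin 3) K 2)
    {L : (PlaneCurve F).Modules} {d : ℤ} (hL : HasDegree (PlaneCurve.toSpec F) L d) (hd : Odd d) :
    ∃ w : Fin 3 → K, w ≠ 0 ∧ MvPolynomial.eval w (F : MvPolynomial (Fin 3) K) = 0 := by
  obtain ⟨-, -, D, -, -, rfl⟩ := hL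
  by_contra h
  rw [← Int.not_even_iff_odd] at hd
  refine hd (Finset.even_sum _ fun x _ => ?_)
  refine Even.mul_left ?_ _
  rw [Int.even_coe_nat, ← Nat.not_odd_iff_even]
  exact fun hx => h (PlaneCurve.exists_eval_eq_zero_of_odd_residueDegree F x hx)

theorem PlaneCurve.exists_eval_eq_zero_of_section
    (p : Spec (.of K) ⟶ PlaneCurve F) (hp : p ≫ PlaneCurve.toSpec F = 𝟙 (Spec (.of K))) :
    ∃ w : Fin 3 → K, w ≠ 0 ∧ MvPolynomial.eval w (F : MvPolynomial (Fin 3) K) = 0 := by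
  have : IsLocalRing (CommRingCat.of K) := inferInstanceAs (IsLocalRing K)
  exact PlaneCurve.exists_coordinates F p (RingHom.id K) (hp.trans (Spec.map_id _).symm)

end Implications

theorem proposition2p6 {K : Type u} [Field K] (F : homogeneousSubmodule (Fin 3) K 2)
    (hF : F ≠ 0) (hsmooth : Smooth (PlaneCurve.toSpec F)) :
    [∃ φ : PlaneCurve F ≅ ProjectiveLine K, φ.hom ≫ ProjectiveLine.toSpec K = PlaneCurve.toSpec F,
      ∃ p : Spec (.of K) ⟶ PlaneCurve F, p ≫ PlaneCurve.toSpec F = 𝟙 (Spec (.of K)),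
      ∃ L : (PlaneCurve F).Modules, IsLineBundle L ∧
        ∃ d : ℤ, HasDegree (PlaneCurve.toSpec F) L d ∧ Odd d,
      ∃ M : Fin 3 → Matrix (Fin 2) (Fin 2) K, IsSymmDetRep F M].TFAE ∧
    ((∃ p : Spec (.of K) ⟶ PlaneCurve F, p ≫ PlaneCurve.toSpec F = 𝟙 (Spec (.of K))) →
      ∃ M : Fin 3 → Matrix (Fin 2) (Fin 2) K, IsSymmDetRep F M ∧
        ∀ N : Fin 3 → Matrix (Fin 2) (Fin 2) K, IsSymmDetRep F N → TripleEquiv M N) := by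
  have hvert := hasNoVertex_of_smooth hF hsmooth
  have hrep (w : Fin 3 → K) (hw : w ≠ 0)
      (h0 : MvPolynomial.eval w (F : MvPolynomial (Fin 3) K) = 0) : ∃ M, IsSymmDetRep F M :=
    exists_isSymmDetRep_of_eval_eq_zero F hvert hw h0
  constructor
  · tfae_have 1 → 2 := by
      rintro ⟨φ, hφ⟩
      obtain ⟨p, hp⟩ := ProjectiveLine.exists_section (K := K)
      exact ⟨p ≫ φ.inv, by rw [← hφ, Category.assoc, Iso.inv_hom_id_assoc, hp]⟩
    tfae_have 1 → 3 := by
      rintro ⟨φ, hφ⟩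
      obtain ⟨L, hL, hd⟩ := PlaneCurve.exists_lineBundle_of_iso F φ hφ
      exact ⟨L, hL, -1, hd, by decide⟩
    tfae_have 2 → 4 := by
      rintro ⟨p, hp⟩
      obtain ⟨w, hw, h0⟩ := PlaneCurve.exists_eval_eq_zero_of_section F p hp
      exact hrep w hw h0
    tfae_have 3 → 4 := by
      rintro ⟨L, -, d, hL, hd⟩
      obtain ⟨w, hw, h0⟩ := PlaneCurve.exists_eval_eq_zero_of_hasDegree F hL hd
      exact hrep w hw h0
    tfae_have 4 → 1 := by
      rintro ⟨M, hM⟩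
      obtain ⟨a, ha⟩ := hM.2
      rw [detForm_eq_of_isSymm hM.1] at ha
      exact exists_iso_projectiveLine F (det_entryMatrix_ne_zero hvert hM) a.ne_zero ha
    tfae_finish
  · rintro ⟨p, hp⟩
    obtain ⟨w, hw, h0⟩ := PlaneCurve.exists_eval_eq_zero_of_section F p hp
    obtain ⟨M, hM⟩ := hrep w hw h0
    exact ⟨M, hM, fun N hN => tripleEquiv_of_isSymmDetRep hvert hM hN⟩

end
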